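/- Let $P=\mathbb{R}_+^d$, let $\mathsf{k}$ be a separable complex Hilbert space (of finite or infinite dimension), and for a nonempty closed set $A\subseteq\mathbb{R}^d$ with $A+P\subseteq A$ let $S^A=\{S^A_x\}_{x\in P}$ be the isometric representation of $P$ on $L^2(A,\mathsf{k})$ (Lebesgue measure) by shifts: $(S^A_xf)(y)=f(y-x)$ if $y-x\in A$, and $0$ otherwise. For an isometric representation $V=\{V_x\}_{x\in P}$ on a Hilbert space $K$ (with $x\mapsto V_x$ and $x\mapsto V_x^*$ strongly continuous), an additive cocycle of $V$ is a continuous map $h:P\to K$ with $h_x\in\ker V_x^*$ and $h_{x+y}=h_x+V_xh_y$ for all $x,y\in P$. Let $\Gamma(K)$ be the symmetric Fock space with exponential vectors $e(u)=\sum_n u^{\otimes n}/\sqrt{n!}$, and for an isometry $W$ let $\Gamma(W)$ be its second quantization, $\Gamma(W)e(u)=e(Wu)$. The CCR flow $\alpha^V$ is the $E_0$-semigroup over $P$ on $B(\Gamma(K))$ given by $\alpha^V_x(T)=1_{\Gamma(\ker V_x^*)}\otimes\Gamma(V_x)T\Gamma(V_x)^*$, where $\Gamma(V_x)$ is regarded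 as a unitary onto $\Gamma(V_xK)$ and $\Gamma(K)$ is identified with $\Gamma(\ker V_x^*)\otimes\Gamma(V_xK)$. A unit of an $E_0$-semigroup $\alpha$ on $B(H)$ is a strongly continuous family $\{u_x\}_{x\in P}$ of bounded operators on $H$, not all zero, with $\alpha_x(T)u_x=u_xT$ and $u_{x+y}=u_xu_y$ for all $x,y\in P$, $T\in B(H)$; $\mathfrak{U}(\alpha)$ denotes the set of units. Say that $\alpha$ is of type II$_0$ if it has a unit $u$ such that every unit $v$ is of the form $v_x=c(x)u_x$ with scalars $c(x)$. (1) Let $d\ge 2$ and $A=\times_{i=1}^d\mathbb{R}_i$, where each $\mathbb{R}_i$ is $\mathbb{R}$ or $\mathbb{R}_+$ and at least one $\mathbb{R}_i$ is $\mathbb{R}_+$. Then the only additive cocycle of $S^A$ is $0$, $$\mathfrak{U}(\alpha^{S^A})=\bigl\{\{e^{\langle x,\mu\rangle}\Gamma(S^A_x)\}_{x\in P}:\mu\in\mathbb{C}^d\bigr\},\qquad \langle x,\mu\rangle=\sum_i x_i\mu_i,$$ and $\alpha^{S^A}$ is of type II$_0$. (2) Let $d=2$, $a<0<b$ and $A_T=A_T^{(a,b)}=[a,\infty)\times[b,\infty)\,\sqcup\,[0,\infty)\times[0,b)$.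 Then the only additive cocycle of $S^{A_T}$ is $0$, $$\mathfrak{U}(\alpha^{S^{A_T}})=\bigl\{\{e^{\langle x,\mu\rangle}\Gamma(S^{A_T}_x)\}_{x\in P}:\mu\in\mathbb{C}^2\bigr\},$$ and $\alpha^{S^{A_T}}$ is of type II$_0$. -/

import Mathlib

open scoped TensorProduct InnerProductSpace

set_option linter.unusedSectionVars false

noncomputable section

namespace CCR

universe u v w

/-! ### Isometries determined by their values on a total family -/

section Gram

variable {ι : Type*} {H : Type*} [NormedAddCommGroup H] [InnerProductSpace ℂ H]
  {H' : Type*} [NormedAddCommGroup H'] [InnerProductSpace ℂ H']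

/-- A family of vectors is total if its linear span is dense. -/
def IsTotal (a : ι → H) : Prop :=
  Dense (Submodule.span ℂ (Set.range a) : Set H)

theorem norm_linearCombination_eq {a : ι → H} {b : ι → H'}
    (h : ∀ i j, ⟪b i, b j⟫_ℂ = ⟪a i, a j⟫_ℂ) (f : ι →₀ ℂ) :
    ‖Finsupp.linearCombination ℂ b f‖ = ‖Finsupp.linearCombination ℂ a f‖ := by
  have key : ⟪Finsupp.linearCombination ℂ b f, Finsupp.linearCombination ℂ b f⟫_ℂ =
      ⟪Finsupp.linearCombination ℂ a f, Finsupp.linearCombination ℂ a f⟫_ℂ := by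
    simp only [Finsupp.linearCombination_apply, Finsupp.sum, sum_inner, inner_sum,
      inner_smul_left, inner_smul_right, h]
  rw [@norm_eq_sqrt_re_inner ℂ, @norm_eq_sqrt_re_inner ℂ, key]

theorem IsTotal.denseRange {a : ι → H} (ha : IsTotal a) :
    DenseRange (Finsupp.linearCombination ℂ a) := by
  have := ha
  rw [IsTotal, ← Finsupp.range_linearCombination] at this
  exact this

theorem IsTotal.ext {a : ι → H} (ha : IsTotal a) {E : Type*} [NormedAddCommGroup E]
    [NormedSpace ℂ E] {S T : H →L[ℂ] E} (h : ∀ i, S (a i) = T (a i)) : S = T := by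
  refine ContinuousLinearMap.ext_on ha ?_
  rintro _ ⟨i, rfl⟩
  exact h i

theorem IsTotal.ext_vec {a : ι → H} (ha : IsTotal a) {x y : H}
    (h : ∀ i, ⟪a i, x⟫_ℂ = ⟪a i, y⟫_ℂ) : x = y := by
  have h1 : x - y ∈ (Submodule.span ℂ (Set.range a))ᗮ := by
    rw [Submodule.mem_orthogonal]
    intro u hu
    induction hu using Submodule.span_induction with
    | mem _ hx => obtain ⟨i, rfl⟩ := hx; rw [inner_sub_right, h i, sub_self]
    | zero => exact inner_zero_left _
    | add u v _ _ hu hv => rw [inner_add_left, hu, hv, add_zero]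
    | smul c u _ hu => rw [inner_smul_left, hu, mul_zero]
  have h2 : ∀ z : H, ⟪z, x - y⟫_ℂ = 0 := by
    intro z
    have hcl : IsClosed {z : H | ⟪z, x - y⟫_ℂ = 0} :=
      isClosed_eq (continuous_id.inner continuous_const) continuous_const
    exact hcl.closure_subset_iff.2 (fun z hz => (Submodule.mem_orthogonal _ _).1 h1 z hz) (ha z)
  exact sub_eq_zero.1 (inner_self_eq_zero.1 (h2 (x - y)))

theorem IsTotal.ext_inner {a : ι → H} (ha : IsTotal a) {S T : H →L[ℂ] H}
    (h : ∀ i j, ⟪a i, S (a j)⟫_ℂ = ⟪a i, T (a j)⟫_ℂ) : S = T :=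
  ha.ext fun j => ha.ext_vec fun i => h i j

theorem isTotal_id : IsTotal (fun x : H => x) := by
  simp [IsTotal]

/-- Given a total family `a` and a family `b` with the same Gram matrix, the unique isometry
which maps `a i` to `b i`. -/
def gramIsometry [CompleteSpace H'] (a : ι → H) (b : ι → H') (ha : IsTotal a)
    (h : ∀ i j, ⟪b i, b j⟫_ℂ = ⟪a i, a j⟫_ℂ) : H →ₗᵢ[ℂ] H' where
  toLinearMap := ((Finsupp.linearCombination ℂ b).extendOfNorm
    (Finsupp.linearCombination ℂ a)).toLinearMap
  norm_map' := by
    refine ha.denseRange.induction ?_ (isClosed_eq ?_ continuous_norm)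
    · rintro _ ⟨f, rfl⟩
      rw [← norm_linearCombination_eq h f]
      congr 1
      exact LinearMap.extendOfNorm_eq ha.denseRange
        ⟨1, fun x => by rw [one_mul, norm_linearCombination_eq h]⟩ f
    · exact continuous_norm.comp (ContinuousLinearMap.continuous _)

theorem gramIsometry_apply [CompleteSpace H'] (a : ι → H) (b : ι → H') (ha : IsTotal a)
    (h : ∀ i j, ⟪b i, b j⟫_ℂ = ⟪a i, a j⟫_ℂ) (i : ι) :
    gramIsometry a b ha h (a i) = b i := by
  have := LinearMap.extendOfNorm_eq (f := Finsupp.linearCombination ℂ b) ha.denseRange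
        ⟨1, fun x => by rw [one_mul, norm_linearCombination_eq h]⟩ (Finsupp.single i 1)
  simp only [Finsupp.linearCombination_single, one_smul] at this
  exact this

/-- The unitary between Hilbert spaces which maps the total family `a` to the total family `b`
with the same Gram matrix. -/
def gramUnitary [CompleteSpace H] [CompleteSpace H'] (a : ι → H) (b : ι → H') (ha : IsTotal a)
    (hb : IsTotal b) (h : ∀ i j, ⟪b i, b j⟫_ℂ = ⟪a i, a j⟫_ℂ) : H ≃ₗᵢ[ℂ] H' :=
  LinearIsometryEquiv.ofSurjective (gramIsometry a b ha h) (by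
    intro y
    have hc : IsClosed (Set.range (gramIsometry a b ha h)) :=
      (gramIsometry a b ha h).isometry.isClosedEmbedding.isClosed_range
    have hs : (Submodule.span ℂ (Set.range b) : Set H') ⊆
        (LinearMap.range (gramIsometry a b ha h).toLinearMap : Set H') := by
      rw [SetLike.coe_subset_coe, Submodule.span_le]
      rintro _ ⟨i, rfl⟩
      exact ⟨a i, gramIsometry_apply a b ha h i⟩
    have := hc.closure_subset_iff.2 hs (hb y)
    simpa using this)

theorem gramUnitary_apply [CompleteSpace H] [CompleteSpace H'] (a : ι → H) (b : ι → H')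
    (ha : IsTotal a) (hb : IsTotal b) (h : ∀ i j, ⟪b i, b j⟫_ℂ = ⟪a i, a j⟫_ℂ) (i : ι) :
    gramUnitary a b ha hb h (a i) = b i :=
  gramIsometry_apply a b ha h i

end Gram

/-! ### The symmetric Fock space -/

/-- A complex inner product space, bundled. -/
structure InnerSpaceBundle : Type (u + 1) where
  carrier : Type u
  [normed : NormedAddCommGroup carrier]
  [inner : InnerProductSpace ℂ carrier]

attribute [instance] InnerSpaceBundle.normed InnerSpaceBundle.inner

section Fock

variable (K : Type u) [NormedAddCommGroup K] [InnerProductSpace ℂ K]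

/-- The `n`-fold Hilbert space tensor power of `K`: the `0`-th power is `ℂ`, and the `(n+1)`-st one
is the completion of the tensor product of `K` with the `n`-th one. -/
def tensorPowBundle : ℕ → InnerSpaceBundle.{u}
  | 0 => ⟨EuclideanSpace ℂ PUnit.{u + 1}⟩
  | n + 1 => ⟨UniformSpace.Completion (K ⊗[ℂ] (tensorPowBundle n).carrier)⟩

/-- The Hilbert space `K^{⊗ n}`. -/
def TensorPow (n : ℕ) : Type u := (tensorPowBundle K n).carrier

instance (n : ℕ) : NormedAddCommGroup (TensorPow K n) := (tensorPowBundle K n).normed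

instance (n : ℕ) : InnerProductSpace ℂ (TensorPow K n) := (tensorPowBundle K n).inner

instance : (n : ℕ) → CompleteSpace (TensorPow K n)
  | 0 => inferInstanceAs (CompleteSpace (EuclideanSpace ℂ PUnit.{u + 1}))
  | n + 1 => inferInstanceAs
      (CompleteSpace (UniformSpace.Completion (K ⊗[ℂ] (TensorPow K n))))

variable {K}

/-- The vector `u ⊗ ⋯ ⊗ u` (`n` factors). -/
def tensorPow (u : K) : (n : ℕ) → TensorPow K n
  | 0 => (EuclideanSpace.single PUnit.unit 1 : EuclideanSpace ℂ PUnit.{u + 1})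
  | n + 1 => ((u ⊗ₜ[ℂ] tensorPow u n : K ⊗[ℂ] (TensorPow K n)) :
      UniformSpace.Completion (K ⊗[ℂ] (TensorPow K n)))

theorem inner_tensorPow (u v : K) (n : ℕ) :
    ⟪tensorPow u n, tensorPow v n⟫_ℂ = ⟪u, v⟫_ℂ ^ n := by
  induction n with
  | zero =>
    change ⟪(EuclideanSpace.single PUnit.unit 1 : EuclideanSpace ℂ PUnit.{u + 1}),
      EuclideanSpace.single PUnit.unit 1⟫_ℂ = _
    simp
  | succ n ih =>
    change ⟪((u ⊗ₜ[ℂ] tensorPow u n : K ⊗[ℂ] (TensorPow K n)) :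
      UniformSpace.Completion (K ⊗[ℂ] (TensorPow K n))),
      ((v ⊗ₜ[ℂ] tensorPow v n : K ⊗[ℂ] (TensorPow K n)) :
      UniformSpace.Completion (K ⊗[ℂ] (TensorPow K n)))⟫_ℂ = _
    rw [UniformSpace.Completion.inner_coe, TensorProduct.inner_tmul, ih, pow_succ']

theorem tensorPow_smul (c : ℂ) (u : K) (n : ℕ) :
    tensorPow (c • u) n = c ^ n • tensorPow u n := by
  induction n with
  | zero => rw [pow_zero, one_smul]; rfl
  | succ n ih =>
    change ((((c • u) ⊗ₜ[ℂ] tensorPow (c • u) n : K ⊗[ℂ] (TensorPow K n))) :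
      UniformSpace.Completion (K ⊗[ℂ] (TensorPow K n))) =
      c ^ (n + 1) • ((u ⊗ₜ[ℂ] tensorPow u n : K ⊗[ℂ] (TensorPow K n)) :
      UniformSpace.Completion (K ⊗[ℂ] (TensorPow K n)))
    rw [ih, ← UniformSpace.Completion.coe_smul, TensorProduct.smul_tmul_smul, pow_succ']

variable (K) in
/-- The symmetric `n`-fold tensor power of `K`, the closed linear span of the vectors
`u ⊗ ⋯ ⊗ u` in `K^{⊗ n}`. -/
def SymPow (n : ℕ) : Submodule ℂ (TensorPow K n) :=
  (Submodule.span ℂ (Set.range fun u : K => tensorPow u n)).topologicalClosure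

instance (n : ℕ) : CompleteSpace (SymPow K n) :=
  (Submodule.isClosed_topologicalClosure _).completeSpace_coe

/-- The vector `u ⊗ ⋯ ⊗ u` as an element of the symmetric tensor power. -/
def symPow (u : K) (n : ℕ) : SymPow K n :=
  ⟨tensorPow u n, Submodule.le_topologicalClosure _ (Submodule.subset_span ⟨u, rfl⟩)⟩

variable (K) in
/-- The symmetric Fock space `Γ(K)`, the Hilbert space direct sum of the symmetric tensor powers
of `K`. -/
abbrev Fock : Type u := lp (fun n : ℕ => SymPow K n) 2

/-- The exponential vector `e(u) = ∑ₙ u^{⊗ n} / √n!`. -/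
def expVec (u : K) : Fock K :=
  ⟨fun n => ((Real.sqrt (n.factorial : ℝ))⁻¹ : ℂ) • symPow u n, by
    refine memℓp_gen ?_
    refine (NormedSpace.expSeries_div_summable (‖u‖ ^ 2)).congr fun n => ?_
    have h1 : ‖symPow u n‖ ^ 2 = (‖u‖ ^ 2) ^ n := by
      have := inner_tensorPow u u n
      rw [inner_self_eq_norm_sq_to_K, inner_self_eq_norm_sq_to_K] at this
      change ‖tensorPow u n‖ ^ 2 = _
      exact_mod_cast this
    rw [norm_smul]
    simp only [ENNReal.toReal_ofNat, Real.rpow_ofNat, mul_pow, h1]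
    simp [Real.sq_sqrt, div_eq_inv_mul]⟩

theorem inner_expVec (u v : K) : ⟪expVec u, expVec v⟫_ℂ = Complex.exp ⟪u, v⟫_ℂ := by
  rw [lp.inner_eq_tsum, Complex.exp_eq_exp_ℂ, NormedSpace.exp_eq_tsum_div]
  refine tsum_congr fun n => ?_
  change ⟪((Real.sqrt (n.factorial : ℝ))⁻¹ : ℂ) • tensorPow u n,
    ((Real.sqrt (n.factorial : ℝ))⁻¹ : ℂ) • tensorPow v n⟫_ℂ = _
  rw [inner_smul_left, inner_smul_right, inner_tensorPow, ← mul_assoc, div_eq_inv_mul]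
  congr 1
  rw [map_inv₀, Complex.conj_ofReal, ← mul_inv, ← Complex.ofReal_mul,
    Real.mul_self_sqrt (by positivity)]
  simp

theorem isTotal_expVec : IsTotal (expVec : K → Fock K) := by
  rw [IsTotal, Submodule.dense_iff_topologicalClosure_eq_top,
    Submodule.topologicalClosure_eq_top_iff, Submodule.eq_bot_iff]
  intro ξ hξ
  rw [Submodule.mem_orthogonal] at hξ
  have h0 : ∀ (u : K) (n : ℕ), ⟪symPow u n, ξ n⟫_ℂ = 0 := by
    intro u
    set c : ℕ → ℂ := fun n => ((Real.sqrt (n.factorial : ℝ))⁻¹ : ℂ) * ⟪ξ n, symPow u n⟫_ℂ with hc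
    have hsum : ∀ z : ℂ, HasSum (fun n => z ^ n * c n) 0 := by
      intro z
      have h1 := lp.hasSum_inner (𝕜 := ℂ) ξ (expVec (z • u))
      have h2 : ⟪ξ, expVec (z • u)⟫_ℂ = 0 := by
        rw [← inner_conj_symm, hξ _ (Submodule.subset_span ⟨_, rfl⟩), map_zero]
      rw [h2] at h1
      have h3 : (fun n => z ^ n * c n) = fun n => ⟪ξ n, expVec (z • u) n⟫_ℂ := by
        funext n
        have : (expVec (z • u) : ∀ n, SymPow K n) n =
            ((Real.sqrt (n.factorial : ℝ))⁻¹ : ℂ) • z ^ n • symPow u n := by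
          apply Subtype.ext
          change ((Real.sqrt (n.factorial : ℝ))⁻¹ : ℂ) • tensorPow (z • u) n =
            ((Real.sqrt (n.factorial : ℝ))⁻¹ : ℂ) • z ^ n • tensorPow u n
          rw [tensorPow_smul]
        rw [this, inner_smul_right, inner_smul_right]
        simp only [hc]
        ring
      rw [h3]
      exact h1
    have hp : HasFPowerSeriesAt (0 : ℂ → ℂ) (FormalMultilinearSeries.ofScalars ℂ c) 0 := by
      rw [hasFPowerSeriesAt_iff]
      refine Filter.Eventually.of_forall fun z => ?_
      simpa using hsum z
    have hc0 := hp.eq_zero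
    intro n
    have h3 : c n = 0 := by
      have := FormalMultilinearSeries.coeff_ofScalars (𝕜 := ℂ) (p := c) (n := n)
      rw [hc0] at this
      exact this.symm
    have h4 : ((Real.sqrt (n.factorial : ℝ))⁻¹ : ℂ) ≠ 0 := by
      rw [← Complex.ofReal_inv, Complex.ofReal_ne_zero]
      have := Real.sqrt_pos.2 (Nat.cast_pos (α := ℝ).2 n.factorial_pos)
      positivity
    rw [← inner_conj_symm, (mul_eq_zero.1 h3).resolve_left h4, map_zero]
  apply lp.ext
  funext n
  have h5 : (ξ n : TensorPow K n) ∈ SymPow K n := (ξ n).2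
  have h6 : SymPow K n ≤ (Submodule.span ℂ {(ξ n : TensorPow K n)})ᗮ := by
    refine Submodule.topologicalClosure_minimal _ ?_ (Submodule.isClosed_orthogonal _)
    rw [Submodule.span_le]
    rintro _ ⟨u, rfl⟩
    rw [SetLike.mem_coe, Submodule.mem_orthogonal_singleton_iff_inner_left]
    exact h0 u n
  have h7 := Submodule.mem_orthogonal_singleton_iff_inner_left.1 (h6 h5)
  exact Subtype.ext (inner_self_eq_zero.1 h7)

end Fock


section Ops

open UniformSpace ContinuousLinearMap Filter Topology

theorem continuous_expVec {K : Type u} [NormedAddCommGroup K] [InnerProductSpace ℂ K] :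
    Continuous (expVec : K → Fock K) := by
  rw [continuous_iff_continuousAt]
  intro u
  rw [ContinuousAt, tendsto_iff_norm_sub_tendsto_zero]
  have h1 : ∀ v : K, ‖expVec v - expVec u‖ =
      Real.sqrt (RCLike.re (Complex.exp ⟪v, v⟫_ℂ - Complex.exp ⟪v, u⟫_ℂ - Complex.exp ⟪u, v⟫_ℂ
        + Complex.exp ⟪u, u⟫_ℂ)) := by
    intro v
    rw [@norm_eq_sqrt_re_inner ℂ, inner_sub_sub_self]
    simp only [inner_expVec]
  simp only [h1]
  have h2 : Continuous fun v : K =>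
      Real.sqrt (RCLike.re (Complex.exp ⟪v, v⟫_ℂ - Complex.exp ⟪v, u⟫_ℂ - Complex.exp ⟪u, v⟫_ℂ
        + Complex.exp ⟪u, u⟫_ℂ)) := by
    refine Real.continuous_sqrt.comp (RCLike.continuous_re.comp ?_)
    fun_prop
  have h3 := h2.tendsto u
  simpa using h3

/-- The second quantization `Γ(V)` of an isometry, the unique isometry with `Γ(V) e(v) = e(V v)`. -/
def secondQuant {K : Type u} [NormedAddCommGroup K] [InnerProductSpace ℂ K]
    {K' : Type v} [NormedAddCommGroup K'] [InnerProductSpace ℂ K'] (V : K →ₗᵢ[ℂ] K') :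
    Fock K →ₗᵢ[ℂ] Fock K' :=
  gramIsometry expVec (fun v => expVec (V v)) isTotal_expVec (fun u v => by
    rw [inner_expVec, inner_expVec, V.inner_map_map])

theorem secondQuant_expVec {K : Type u} [NormedAddCommGroup K] [InnerProductSpace ℂ K]
    {K' : Type v} [NormedAddCommGroup K'] [InnerProductSpace ℂ K'] (V : K →ₗᵢ[ℂ] K') (v : K) :
    secondQuant V (expVec v) = expVec (V v) :=
  gramIsometry_apply _ _ _ _ v

/-! ### Hilbert space tensor products -/

section HTensor

variable (E : Type u) [NormedAddCommGroup E] [InnerProductSpace ℂ E]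
  {F : Type v} [NormedAddCommGroup F] [InnerProductSpace ℂ F]

variable (F) in
/-- The Hilbert space tensor product, the completion of the algebraic one. -/
abbrev HTensor : Type (max u v) := Completion (E ⊗[ℂ] F)

variable {E} in
/-- The elementary tensor `x ⊗ y` in the Hilbert space tensor product. -/
def htmul (x : E) (y : F) : HTensor E F := ((x ⊗ₜ[ℂ] y : E ⊗[ℂ] F) : Completion (E ⊗[ℂ] F))

variable {E} in
theorem inner_htmul (x x' : E) (y y' : F) :
    ⟪htmul x y, htmul x' y'⟫_ℂ = ⟪x, x'⟫_ℂ * ⟪y, y'⟫_ℂ := by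
  rw [htmul, htmul, Completion.inner_coe, TensorProduct.inner_tmul]

variable {E} in
theorem isTotal_htmul {ι κ : Type*} {a : ι → E} {b : κ → F} (ha : IsTotal a) (hb : IsTotal b) :
    IsTotal (fun p : ι × κ => htmul (a p.1) (b p.2)) := by
  have hcont : Continuous fun p : E × F => htmul p.1 p.2 :=
    (Completion.continuous_coe _).comp TensorProduct.continuous_tmul
  set M := (Submodule.span ℂ (Set.range fun p : ι × κ => htmul (a p.1) (b p.2))).topologicalClosure
    with hM
  have hMc : IsClosed (M : Set (HTensor E F)) := Submodule.isClosed_topologicalClosure _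
  have h1 : ∀ (i : ι) (y : F), htmul (a i) y ∈ M := by
    intro i y
    have hle : Submodule.span ℂ (Set.range b) ≤
        M.comap ((Completion.toComplL (𝕜 := ℂ) (E := E ⊗[ℂ] F)).toLinearMap ∘ₗ
          TensorProduct.mk ℂ E F (a i)) := by
      rw [Submodule.span_le]
      rintro _ ⟨j, rfl⟩
      exact Submodule.le_topologicalClosure _ (Submodule.subset_span ⟨(i, j), rfl⟩)
    have hcl : IsClosed {y : F | htmul (a i) y ∈ M} :=
      hMc.preimage (hcont.comp (Continuous.prodMk continuous_const continuous_id))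
    exact hcl.closure_subset_iff.2 (fun z hz => hle hz) (hb y)
  have h2 : ∀ (x : E) (y : F), htmul x y ∈ M := by
    intro x y
    have hle : Submodule.span ℂ (Set.range a) ≤
        M.comap ((Completion.toComplL (𝕜 := ℂ) (E := E ⊗[ℂ] F)).toLinearMap ∘ₗ
          (TensorProduct.mk ℂ E F).flip y) := by
      rw [Submodule.span_le]
      rintro _ ⟨i, rfl⟩
      exact h1 i y
    have hcl : IsClosed {x : E | htmul x y ∈ M} :=
      hMc.preimage (hcont.comp (Continuous.prodMk continuous_id continuous_const))
    exact hcl.closure_subset_iff.2 (fun z hz => hle hz) (ha x)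
  have h3 : ∀ z : E ⊗[ℂ] F, (z : Completion (E ⊗[ℂ] F)) ∈ M := by
    intro z
    induction z using TensorProduct.induction_on with
    | zero => rw [Completion.coe_zero]; exact M.zero_mem
    | tmul x y => exact h2 x y
    | add z w hz hw => rw [Completion.coe_add]; exact M.add_mem hz hw
  rw [IsTotal, Submodule.dense_iff_topologicalClosure_eq_top, ← hM, Submodule.eq_top_iff']
  intro z
  induction z using Completion.induction_on with
  | hp => exact hMc
  | ih z => exact h3 z

variable {E} in
theorem HTensor.ext {G : Type*} [NormedAddCommGroup G] [NormedSpace ℂ G]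
    {S T : HTensor E F →L[ℂ] G} (h : ∀ x y, S (htmul x y) = T (htmul x y)) : S = T := by
  refine (isTotal_htmul isTotal_id isTotal_id).ext ?_
  rintro ⟨x, y⟩
  exact h x y

/-- The operator `1 ⊗ T` on the Hilbert space tensor product. -/
def idTensor (T : F →L[ℂ] F) : HTensor E F →L[ℂ] HTensor E F := (T.lTensor E).completion

theorem idTensor_htmul (T : F →L[ℂ] F) (x : E) (y : F) :
    idTensor E T (htmul x y) = htmul x (T y) := by
  rw [idTensor, htmul, completion_apply_coe]
  rfl

/-- The unital `*`-homomorphism `T ↦ 1 ⊗ T`. -/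
def idTensorHom [CompleteSpace F] :
    (F →L[ℂ] F) →⋆ₐ[ℂ] (HTensor E F →L[ℂ] HTensor E F) where
  toFun := idTensor E
  map_one' := HTensor.ext fun x y => by rw [idTensor_htmul]; rfl
  map_mul' S T := HTensor.ext fun x y => by
    rw [mul_apply_eq_comp, idTensor_htmul, idTensor_htmul, idTensor_htmul]; rfl
  map_zero' := HTensor.ext fun x y => by
    rw [idTensor_htmul]; simp [htmul]
  map_add' S T := HTensor.ext fun x y => by
    rw [add_apply, idTensor_htmul, idTensor_htmul, idTensor_htmul]
    simp [htmul, TensorProduct.tmul_add, Completion.coe_add]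
  commutes' c := HTensor.ext fun x y => by
    rw [idTensor_htmul]
    simp [htmul, Algebra.algebraMap_eq_smul_one]
  map_star' T := by
    refine (isTotal_htmul isTotal_id isTotal_id).ext_inner ?_
    rintro ⟨x, y⟩ ⟨x', y'⟩
    rw [star_eq_adjoint, star_eq_adjoint, adjoint_inner_right, idTensor_htmul, idTensor_htmul,
      inner_htmul, inner_htmul, adjoint_inner_right]

end HTensor


/-! ### Convergence of matrix coefficients -/

section Coefficients

variable {X ι : Type*} {H : Type*} [NormedAddCommGroup H] [InnerProductSpace ℂ H]

theorem IsTotal.tendsto_right {a : ι → H} (ha : IsTotal a) {l : Filter X} {f : X → H} {f₀ : H}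
    {C : ℝ} (hf : ∀ᶠ x in l, ‖f x‖ ≤ C)
    (h : ∀ i, Tendsto (fun x => ⟪f x, a i⟫_ℂ) l (𝓝 ⟪f₀, a i⟫_ℂ)) (η : H) :
    Tendsto (fun x => ⟪f x, η⟫_ℂ) l (𝓝 ⟪f₀, η⟫_ℂ) := by
  have hspan : ∀ η ∈ Submodule.span ℂ (Set.range a),
      Tendsto (fun x => ⟪f x, η⟫_ℂ) l (𝓝 ⟪f₀, η⟫_ℂ) := by
    intro η hη
    induction hη using Submodule.span_induction with
    | mem _ hx => obtain ⟨i, rfl⟩ := hx; exact h i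
    | zero => simpa only [inner_zero_right] using tendsto_const_nhds
    | add u v _ _ hu hv => simpa only [inner_add_right] using hu.add hv
    | smul c u _ hu => simpa only [inner_smul_right] using hu.const_mul c
  rw [Metric.tendsto_nhds]
  intro ε hε
  have hC : 0 < |C| + ‖f₀‖ + 1 := by positivity
  obtain ⟨η', hη', hd⟩ := Metric.mem_closure_iff.1 (ha η) (ε / 2 / (|C| + ‖f₀‖ + 1))
    (by positivity)
  filter_upwards [hf, (Metric.tendsto_nhds.1 (hspan η' hη')) (ε / 2) (by positivity)] with x hx hx'
  rw [dist_eq_norm] at hx' hd ⊢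
  have e1 : ⟪f x, η⟫_ℂ - ⟪f₀, η⟫_ℂ = ⟪f x - f₀, η - η'⟫_ℂ + (⟪f x, η'⟫_ℂ - ⟪f₀, η'⟫_ℂ) := by
    simp only [inner_sub_left, inner_sub_right]; ring
  have e2 : ‖⟪f x - f₀, η - η'⟫_ℂ‖ ≤ ε / 2 := by
    refine (norm_inner_le_norm _ _).trans ?_
    have e3 : ‖f x - f₀‖ ≤ |C| + ‖f₀‖ + 1 := by
      have := norm_sub_le (f x) f₀
      have := le_abs_self C
      linarith
    calc ‖f x - f₀‖ * ‖η - η'‖ ≤ (|C| + ‖f₀‖ + 1) * (ε / 2 / (|C| + ‖f₀‖ + 1)) := by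
          gcongr
      _ = ε / 2 := by field_simp
  rw [e1]
  have := norm_add_le ⟪f x - f₀, η - η'⟫_ℂ (⟪f x, η'⟫_ℂ - ⟪f₀, η'⟫_ℂ)
  linarith

theorem IsTotal.tendsto_inner [CompleteSpace H] {a : ι → H} (ha : IsTotal a) {l : Filter X}
    {S : X → H →L[ℂ] H} {S₀ : H →L[ℂ] H} {C : ℝ} (hS : ∀ᶠ x in l, ‖S x‖ ≤ C)
    (h : ∀ i j, Tendsto (fun x => ⟪a i, S x (a j)⟫_ℂ) l (𝓝 ⟪a i, S₀ (a j)⟫_ℂ)) (ξ η : H) :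
    Tendsto (fun x => ⟪ξ, S x η⟫_ℂ) l (𝓝 ⟪ξ, S₀ η⟫_ℂ) := by
  have h1 : ∀ i, Tendsto (fun x => ⟪a i, S x η⟫_ℂ) l (𝓝 ⟪a i, S₀ η⟫_ℂ) := by
    intro i
    simp only [← adjoint_inner_left]
    refine ha.tendsto_right (C := C * ‖a i‖) ?_ ?_ η
    · filter_upwards [hS] with x hx
      refine (le_opNorm _ _).trans ?_
      rw [LinearIsometryEquiv.norm_map]
      gcongr
    · intro j
      simpa only [adjoint_inner_left] using h i j
  have h2 : Tendsto (fun x => ⟪S x η, ξ⟫_ℂ) l (𝓝 ⟪S₀ η, ξ⟫_ℂ) := by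
    refine ha.tendsto_right (C := C * ‖η‖) ?_ ?_ ξ
    · filter_upwards [hS] with x hx
      refine (le_opNorm _ _).trans ?_
      gcongr
    · intro i
      have := (Complex.continuous_conj.tendsto _).comp (h1 i)
      simpa only [Function.comp_def, inner_conj_symm] using this
  have := (Complex.continuous_conj.tendsto _).comp h2
  simpa only [Function.comp_def, inner_conj_symm] using this

end Coefficients

/-! ### `E₀`-semigroups and units -/

section E0

variable {P : Type*} [AddCommMonoid P] [TopologicalSpace P]
  {H : Type*} [NormedAddCommGroup H] [InnerProductSpace ℂ H] [CompleteSpace H]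

/-- A map on `B(H)` is normal if it is continuous on bounded sets for the weak operator topology
(equivalently, for linear maps, continuous for the `σ`-weak topology): bounded nets which converge
weakly are mapped to weakly convergent nets. -/
def IsNormalMap (φ : (H →L[ℂ] H) → (H →L[ℂ] H)) : Prop :=
  ∀ (l : Filter (H →L[ℂ] H)) (C : ℝ) (T : H →L[ℂ] H), (∀ᶠ S in l, ‖S‖ ≤ C) →
    (∀ ξ η : H, Tendsto (fun S : H →L[ℂ] H => ⟪ξ, S η⟫_ℂ) l (𝓝 ⟪ξ, T η⟫_ℂ)) →
    ∀ ξ η : H, Tendsto (fun S : H →L[ℂ] H => ⟪ξ, φ S η⟫_ℂ) l (𝓝 ⟪ξ, φ T η⟫_ℂ)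

variable (P H) in
/-- An `E₀`-semigroup over `P` on `B(H)`: a weakly continuous semigroup, indexed by `P`, of normal
unital `*`-endomorphisms of `B(H)`. -/
structure E0Semigroup where
  toFun : P → (H →L[ℂ] H) →⋆ₐ[ℂ] (H →L[ℂ] H)
  normal : ∀ x, IsNormalMap (toFun x)
  map_zero : ∀ T, toFun 0 T = T
  map_add : ∀ x y T, toFun (x + y) T = toFun x (toFun y T)
  continuous : ∀ (T : H →L[ℂ] H) (ξ η : H), Continuous fun x => ⟪toFun x T ξ, η⟫_ℂ

/-- A unit of an `E₀`-semigroup `α`: a strongly continuous semigroup of operators `u x`, not all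
zero, which intertwine: `α_x(T) u_x = u_x T`. -/
structure IsUnitOf (α : E0Semigroup P H) (u : P → H →L[ℂ] H) : Prop where
  continuous : ∀ ξ : H, Continuous fun x => u x ξ
  intertwine : ∀ (x : P) (T : H →L[ℂ] H), α.toFun x T ∘L u x = u x ∘L T
  map_add : ∀ x y : P, u (x + y) = u x ∘L u y
  exists_ne_zero : ∃ x : P, u x ≠ 0

/-- The set of all units of an `E₀`-semigroup. -/
def unitSet (α : E0Semigroup P H) : Set (P → H →L[ℂ] H) := {u | IsUnitOf α u}

/-- An `E₀`-semigroup is of type II₀ if it admits a unit and only one unit up to scalars. -/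
def IsTypeII0 (α : E0Semigroup P H) : Prop :=
  ∃ u ∈ unitSet α, ∀ v ∈ unitSet α, ∃ c : P → ℂ, ∀ x, v x = c x • u x

end E0

/-! ### Isometric representations, additive cocycles and CCR flows -/

section CCRFlow

variable {P : Type*} [AddCommMonoid P] [TopologicalSpace P]
  {K : Type u} [NormedAddCommGroup K] [InnerProductSpace ℂ K] [CompleteSpace K]

variable (P K) in
/-- A strictly continuous isometric representation of `P` on `K`. -/
structure IsometricRep where
  toFun : P → K →ₗᵢ[ℂ] K
  map_add : ∀ x y ξ, toFun (x + y) ξ = toFun x (toFun y ξ)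
  continuous : ∀ ξ : K, Continuous fun x => toFun x ξ
  continuous_adjoint : ∀ ξ : K, Continuous fun x => adjoint (toFun x).toContinuousLinearMap ξ

theorem IsometricRep.map_zero (V : IsometricRep P K) (ξ : K) : V.toFun 0 ξ = ξ := by
  apply (V.toFun 0).injective
  rw [← V.map_add, add_zero]

/-- An additive cocycle of an isometric representation `V`: a continuous function `h : P → K` with
`h_x ∈ ker V_x^*` and `h_{x+y} = h_x + V_x h_y`. -/
structure IsAdditiveCocycle (V : IsometricRep P K) (h : P → K) : Prop where
  continuous : Continuous h
  mem_ker : ∀ x, adjoint (V.toFun x).toContinuousLinearMap (h x) = 0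
  map_add : ∀ x y, h (x + y) = h x + V.toFun x (h y)

/-- The subspace `ker V^*`. -/
def kerAdjoint (V : K →ₗᵢ[ℂ] K) : Submodule ℂ K :=
  LinearMap.ker (adjoint V.toContinuousLinearMap).toLinearMap

theorem adjoint_apply_self (V : K →ₗᵢ[ℂ] K) (ξ : K) :
    adjoint V.toContinuousLinearMap (V ξ) = ξ := by
  refine ext_inner_left ℂ fun η => ?_
  rw [adjoint_inner_right]
  exact V.inner_map_map _ _

theorem adjoint_apply_ker (V : K →ₗᵢ[ℂ] K) (w : kerAdjoint V) :
    adjoint V.toContinuousLinearMap (w : K) = 0 := w.2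

theorem inner_ker_add (V : K →ₗᵢ[ℂ] K) (w w' : kerAdjoint V) (v v' : K) :
    ⟪(w : K) + V v, (w' : K) + V v'⟫_ℂ = ⟪w, w'⟫_ℂ + ⟪v, v'⟫_ℂ := by
  have h1 : ∀ (w : kerAdjoint V) (v : K), ⟪(w : K), V v⟫_ℂ = 0 := by
    intro w v
    have := adjoint_inner_left V.toContinuousLinearMap v (w : K)
    rw [adjoint_apply_ker, inner_zero_left] at this
    exact this.symm
  have h2 : ∀ (w : kerAdjoint V) (v : K), ⟪V v, (w : K)⟫_ℂ = 0 := by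
    intro w v
    rw [← inner_conj_symm, h1, _root_.map_zero]
  rw [inner_add_left, inner_add_right, inner_add_right, h1, h2, V.inner_map_map,
    Submodule.coe_inner]
  ring

theorem exists_ker_add (V : K →ₗᵢ[ℂ] K) (u : K) :
    ∃ w : kerAdjoint V, (w : K) + V (adjoint V.toContinuousLinearMap u) = u := by
  refine ⟨⟨u - V (adjoint V.toContinuousLinearMap u), ?_⟩, by simp⟩
  change adjoint V.toContinuousLinearMap (u - V (adjoint V.toContinuousLinearMap u)) = 0
  rw [map_sub, adjoint_apply_self, sub_self]

/-- The unitary `Γ(ker V^*) ⊗ Γ(K) → Γ(K)` which maps `e(w) ⊗ e(v)` to `e(w + V v)`, that is,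
`1 ⊗ Γ(V)` followed by the identification of `Γ(ker V^*) ⊗ Γ(V K)` with `Γ(K)`. -/
def fockSplit (V : K →ₗᵢ[ℂ] K) : HTensor (Fock (kerAdjoint V)) (Fock K) ≃ₗᵢ[ℂ] Fock K :=
  gramUnitary (fun p : kerAdjoint V × K => htmul (expVec p.1) (expVec p.2))
    (fun p => expVec ((p.1 : K) + V p.2))
    (isTotal_htmul isTotal_expVec isTotal_expVec)
    (by
      have h : Set.range (fun p : kerAdjoint V × K => expVec ((p.1 : K) + V p.2)) =
          Set.range (expVec : K → Fock K) := by
        refine Set.Subset.antisymm ?_ ?_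
        · rintro _ ⟨p, rfl⟩
          exact ⟨_, rfl⟩
        · rintro _ ⟨u, rfl⟩
          obtain ⟨w, hw⟩ := exists_ker_add V u
          exact ⟨(w, adjoint V.toContinuousLinearMap u), by simp only [hw]⟩
      have := isTotal_expVec (K := K)
      rw [IsTotal, ← h] at this
      exact this)
    (by
      rintro ⟨w, v⟩ ⟨w', v'⟩
      rw [inner_expVec, inner_htmul, inner_expVec, inner_expVec, inner_ker_add, Complex.exp_add])

theorem fockSplit_htmul (V : K →ₗᵢ[ℂ] K) (w : kerAdjoint V) (v : K) :
    fockSplit V (htmul (expVec w) (expVec v)) = expVec ((w : K) + V v) :=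
  gramUnitary_apply _ _ _ _ _ (w, v)

/-- The unital `*`-endomorphism `T ↦ 1_{Γ(ker V^*)} ⊗ Γ(V) T Γ(V)^*` of `B(Γ(K))`, where `Γ(V)` is
considered as a unitary from `Γ(K)` to `Γ(V K)`. -/
def ccrEndo (V : K →ₗᵢ[ℂ] K) : (Fock K →L[ℂ] Fock K) →⋆ₐ[ℂ] (Fock K →L[ℂ] Fock K) :=
  (fockSplit V).conjStarAlgEquiv.toStarAlgHom.comp (idTensorHom (Fock (kerAdjoint V)))

theorem ccrEndo_apply_fockSplit (V : K →ₗᵢ[ℂ] K) (T : Fock K →L[ℂ] Fock K)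
    (z : HTensor (Fock (kerAdjoint V)) (Fock K)) :
    ccrEndo V T (fockSplit V z) = fockSplit V (idTensor _ T z) := by
  change fockSplit V (idTensor _ T ((fockSplit V).symm (fockSplit V z))) = _
  rw [LinearIsometryEquiv.symm_apply_apply]

theorem inner_ccrEndo (V : K →ₗᵢ[ℂ] K) (T : Fock K →L[ℂ] Fock K) (u v : K) :
    ⟪expVec u, ccrEndo V T (expVec v)⟫_ℂ =
      Complex.exp (⟪u, v⟫_ℂ - ⟪adjoint V.toContinuousLinearMap u, adjoint V.toContinuousLinearMap v⟫_ℂ) *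
        ⟪expVec (adjoint V.toContinuousLinearMap u), T (expVec (adjoint V.toContinuousLinearMap v))⟫_ℂ := by
  obtain ⟨w, hw⟩ := exists_ker_add V u
  obtain ⟨w', hw'⟩ := exists_ker_add V v
  have h1 : ⟪u, v⟫_ℂ - ⟪adjoint V.toContinuousLinearMap u, adjoint V.toContinuousLinearMap v⟫_ℂ =
      ⟪w, w'⟫_ℂ := by
    have := inner_ker_add V w w' (adjoint V.toContinuousLinearMap u) (adjoint V.toContinuousLinearMap v)
    rw [hw, hw'] at this
    rw [this]; ring
  rw [h1]
  conv_lhs => rw [← hw, ← hw']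
  rw [← fockSplit_htmul, ← fockSplit_htmul, ccrEndo_apply_fockSplit,
    LinearIsometryEquiv.inner_map_map, idTensor_htmul, inner_htmul, inner_expVec]

/-- The CCR flow `α^V` on `B(Γ(K))` associated with an isometric representation `V` on `K`. -/
def ccrFlow (V : IsometricRep P K) : E0Semigroup P (Fock K) where
  toFun x := ccrEndo (V.toFun x)
  normal x := by
    intro l C T hl hT
    refine isTotal_expVec.tendsto_inner (C := C) ?_ ?_
    · filter_upwards [hl] with S hS
      exact (NonUnitalStarAlgHom.norm_apply_le _ S).trans hS
    · intro u v
      simp only [inner_ccrEndo]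
      exact (hT _ _).const_mul _
  map_zero T := by
    refine isTotal_expVec.ext_inner fun u v => ?_
    have h : ∀ u, adjoint (V.toFun 0).toContinuousLinearMap u = u := by
      intro u
      have := adjoint_apply_self (V.toFun 0) u
      rwa [V.map_zero] at this
    rw [inner_ccrEndo, h, h, sub_self, Complex.exp_zero, one_mul]
  map_add x y T := by
    refine isTotal_expVec.ext_inner fun u v => ?_
    have h : ∀ u, adjoint (V.toFun (x + y)).toContinuousLinearMap u =
        adjoint (V.toFun y).toContinuousLinearMap (adjoint (V.toFun x).toContinuousLinearMap u) := by
      intro u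
      refine ext_inner_left ℂ fun η => ?_
      rw [adjoint_inner_right, adjoint_inner_right, adjoint_inner_right]
      exact congrArg (fun z => ⟪z, u⟫_ℂ) (V.map_add x y η)
    rw [inner_ccrEndo, inner_ccrEndo, inner_ccrEndo, h, h, ← mul_assoc, ← Complex.exp_add]
    congr 2
    ring
  continuous T ξ η := by
    rw [continuous_iff_continuousAt]
    intro x₀
    have key : ∀ ξ η : Fock K, Tendsto (fun x => ⟪ξ, ccrEndo (V.toFun x) T η⟫_ℂ) (𝓝 x₀)
        (𝓝 ⟪ξ, ccrEndo (V.toFun x₀) T η⟫_ℂ) := by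
      refine isTotal_expVec.tendsto_inner (C := ‖T‖) ?_ ?_
      · exact Eventually.of_forall fun x => NonUnitalStarAlgHom.norm_apply_le _ T
      · intro u v
        simp only [inner_ccrEndo]
        have hu := V.continuous_adjoint u
        have hv := V.continuous_adjoint v
        have hc : Continuous fun x =>
            Complex.exp (⟪u, v⟫_ℂ - ⟪adjoint (V.toFun x).toContinuousLinearMap u,
              adjoint (V.toFun x).toContinuousLinearMap v⟫_ℂ) *
            ⟪expVec (adjoint (V.toFun x).toContinuousLinearMap u),
              T (expVec (adjoint (V.toFun x).toContinuousLinearMap v))⟫_ℂ := by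
          refine (Complex.continuous_exp.comp (continuous_const.sub (hu.inner hv))).mul ?_
          exact (continuous_expVec.comp hu).inner (T.continuous.comp (continuous_expVec.comp hv))
        exact hc.tendsto x₀
    have := (Complex.continuous_conj.tendsto _).comp (key η ξ)
    simpa only [ContinuousAt, Function.comp_def, inner_conj_symm] using this

end CCRFlow

end Ops

/-! ### Shifts on `P`-modules, for `P = ℝ₊ᵈ` -/

section Shift

open MeasureTheory Filter Topology
open scoped NNReal ENNReal

/-- The cone `ℝ₊ᵈ`. -/
abbrev Orthant (d : ℕ) : Type := Fin d → ℝ≥0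

/-- The inclusion of `ℝ₊ᵈ` into `ℝᵈ`. -/
def Orthant.toVec {d : ℕ} (x : Orthant d) : Fin d → ℝ := fun i => (x i : ℝ)

theorem Orthant.continuous_toVec {d : ℕ} : Continuous (Orthant.toVec (d := d)) := by
  unfold Orthant.toVec
  fun_prop

/-- A `P`-module for `P = ℝ₊ᵈ`: a nonempty closed subset `A` of `ℝᵈ` with `A + P ⊆ A`. -/
structure PModule (d : ℕ) where
  carrier : Set (Fin d → ℝ)
  isClosed : IsClosed carrier
  nonempty : carrier.Nonempty
  add_mem : ∀ y ∈ carrier, ∀ x : Orthant d, y + x.toVec ∈ carrier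

variable {d : ℕ} {k : Type u} [NormedAddCommGroup k] [InnerProductSpace ℂ k]

theorem PModule.measurableSet (A : PModule d) : MeasurableSet A.carrier := A.isClosed.measurableSet

variable (k) in
/-- The Hilbert space `L²(A, k)`. -/
abbrev PModule.L2 (A : PModule d) : Type u := Lp k 2 (volume.restrict A.carrier)

/-- The shifted function `y ↦ f (y - x)` if `y - x ∈ A`, and `0` otherwise. -/
def shiftFun (A : Set (Fin d → ℝ)) (x : Fin d → ℝ) (f : (Fin d → ℝ) → k) : (Fin d → ℝ) → k :=
  {y | y - x ∈ A}.indicator fun y => f (y - x)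

theorem shiftFun_eq (A : Set (Fin d → ℝ)) (x : Fin d → ℝ) (f : (Fin d → ℝ) → k) :
    shiftFun A x f = fun y => A.indicator f (y - x) := rfl

theorem measurePreserving_sub_vec (x : Fin d → ℝ) :
    MeasurePreserving (fun y : Fin d → ℝ => y - x) volume volume :=
  measurePreserving_sub_right volume x

theorem shiftFun_congr {A : Set (Fin d → ℝ)} (hA : MeasurableSet A) (x : Fin d → ℝ)
    {f g : (Fin d → ℝ) → k} (h : f =ᵐ[volume.restrict A] g) :
    shiftFun A x f =ᵐ[volume] shiftFun A x g := by
  have h1 : A.indicator f =ᵐ[volume] A.indicator g := (ae_eq_restrict_iff_indicator_ae_eq hA).1 h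
  exact (measurePreserving_sub_vec x).quasiMeasurePreserving.ae_eq_comp h1

theorem eLpNorm_shiftFun (A : PModule d) (x : Orthant d) {f : (Fin d → ℝ) → k}
    (hf : AEStronglyMeasurable f (volume.restrict A.carrier)) :
    eLpNorm (shiftFun A.carrier x.toVec f) 2 (volume.restrict A.carrier) =
      eLpNorm f 2 (volume.restrict A.carrier) := by
  have h1 : A.carrier.indicator (shiftFun A.carrier x.toVec f) =
      shiftFun A.carrier x.toVec f := by
    rw [Set.indicator_eq_self]
    intro y hy
    have h2 : y - x.toVec ∈ A.carrier := by
      by_contra h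
      exact hy (Set.indicator_of_notMem (s := {y | y - x.toVec ∈ A.carrier}) h _)
    simpa using A.add_mem _ h2 x
  rw [← eLpNorm_indicator_eq_eLpNorm_restrict A.measurableSet, h1,
    ← eLpNorm_indicator_eq_eLpNorm_restrict A.measurableSet, shiftFun_eq]
  exact eLpNorm_comp_measurePreserving (g := A.carrier.indicator f)
    ((aestronglyMeasurable_indicator_iff A.measurableSet).2 hf) (measurePreserving_sub_vec x.toVec)

theorem memLp_shiftFun (A : PModule d) (x : Orthant d) {f : (Fin d → ℝ) → k}
    (hf : MemLp f 2 (volume.restrict A.carrier)) :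
    MemLp (shiftFun A.carrier x.toVec f) 2 (volume.restrict A.carrier) := by
  refine ⟨?_, by rw [eLpNorm_shiftFun A x hf.1]; exact hf.2⟩
  have h1 := (aestronglyMeasurable_indicator_iff A.measurableSet).2 hf.1
  exact (h1.comp_measurePreserving (measurePreserving_sub_vec x.toVec)).restrict

/-- The shift operator `S^A_x` on `L²(A, k)`: `(S^A_x f)(y) = f (y - x)` if `y - x ∈ A`, and
`0` otherwise. -/
def shift (A : PModule d) (x : Orthant d) : A.L2 k →ₗᵢ[ℂ] A.L2 k where
  toFun f := (memLp_shiftFun A x (Lp.memLp f)).toLp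
  map_add' f g := by
    rw [← MemLp.toLp_add, MemLp.toLp_eq_toLp_iff]
    refine ae_restrict_of_ae ?_
    refine (shiftFun_congr A.measurableSet _ (Lp.coeFn_add f g)).trans (ae_of_all _ fun y => ?_)
    simp only [shiftFun_eq, Set.indicator_add', Pi.add_apply]
  map_smul' c f := by
    rw [RingHom.id_apply, ← MemLp.toLp_const_smul, MemLp.toLp_eq_toLp_iff]
    refine ae_restrict_of_ae ?_
    refine (shiftFun_congr A.measurableSet _ (Lp.coeFn_smul c f)).trans (ae_of_all _ fun y => ?_)
    simp only [shiftFun_eq, Pi.smul_apply]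
    exact congrFun (Set.indicator_const_smul A.carrier c f) _
  norm_map' f := by
    change ‖(memLp_shiftFun A x (Lp.memLp f)).toLp‖ = _
    rw [Lp.norm_toLp, eLpNorm_shiftFun A x (Lp.memLp f).1, Lp.norm_def]

theorem coeFn_shift (A : PModule d) (x : Orthant d) (f : A.L2 k) :
    shift A x f =ᵐ[volume.restrict A.carrier] shiftFun A.carrier x.toVec f :=
  MemLp.coeFn_toLp (memLp_shiftFun A x (Lp.memLp f))

theorem shift_add (A : PModule d) (x y : Orthant d) (f : A.L2 k) :
    shift A (x + y) f = shift A x (shift A y f) := by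
  apply Lp.ext
  refine (coeFn_shift A _ f).trans (EventuallyEq.trans ?_ (coeFn_shift A x _).symm)
  have h1 : shiftFun A.carrier x.toVec (shift A y f) =ᵐ[volume.restrict A.carrier]
      shiftFun A.carrier x.toVec (shiftFun A.carrier y.toVec f) :=
    ae_restrict_of_ae (shiftFun_congr A.measurableSet x.toVec (coeFn_shift A y f))
  refine EventuallyEq.trans (ae_of_all _ fun z => ?_) h1.symm
  have hxy : z - (x + y).toVec = z - x.toVec - y.toVec := by
    rw [sub_sub]; rfl
  simp only [shiftFun_eq]
  by_cases h : z - x.toVec - y.toVec ∈ A.carrier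
  · have h' : z - x.toVec ∈ A.carrier := by simpa using A.add_mem _ h y
    rw [hxy, Set.indicator_of_mem h', Set.indicator_of_mem h]
  · rw [hxy, Set.indicator_of_notMem h]
    by_cases h' : z - x.toVec ∈ A.carrier
    · rw [Set.indicator_of_mem h', Set.indicator_of_notMem h]
    · rw [Set.indicator_of_notMem h']

theorem memLp_indicator (A : PModule d) (f : A.L2 k) :
    MemLp (A.carrier.indicator (f : (Fin d → ℝ) → k)) 2 volume :=
  (memLp_indicator_iff_restrict A.measurableSet).2 (Lp.memLp f)

/-- Extension by zero, from `L²(A, k)` to `L²(ℝᵈ, k)`. -/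
def extendZero (A : PModule d) (f : A.L2 k) : Lp k 2 (volume : Measure (Fin d → ℝ)) :=
  (memLp_indicator A f).toLp

theorem coeFn_extendZero (A : PModule d) (f : A.L2 k) :
    extendZero A f =ᵐ[volume] A.carrier.indicator (f : (Fin d → ℝ) → k) :=
  MemLp.coeFn_toLp (memLp_indicator A f)

/-- Translation on `L²(ℝᵈ, k)`. -/
def translate (x : Fin d → ℝ) (f : Lp k 2 (volume : Measure (Fin d → ℝ))) :
    Lp k 2 (volume : Measure (Fin d → ℝ)) :=
  Lp.compMeasurePreserving (fun y => y - x) (measurePreserving_sub_vec x) f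

theorem continuous_translate (f : Lp k 2 (volume : Measure (Fin d → ℝ))) :
    Continuous fun x => translate x f := by
  let g : C(Fin d → ℝ, C(Fin d → ℝ, Fin d → ℝ)) :=
    ContinuousMap.curry ⟨fun p => p.2 - p.1, by fun_prop⟩
  exact Continuous.compMeasurePreservingLp (f := fun _ => f) (g := g) continuous_const
    g.continuous (fun x => measurePreserving_sub_vec x) (by simp)

theorem inner_translate (x : Fin d → ℝ) (f g : Lp k 2 (volume : Measure (Fin d → ℝ))) :
    ⟪translate x f, g⟫_ℂ = ⟪f, translate (-x) g⟫_ℂ := by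
  have h1 : translate x (translate (-x) g) = g := by
    apply Lp.ext
    refine (Lp.coeFn_compMeasurePreserving _ (measurePreserving_sub_vec x)).trans ?_
    refine ((measurePreserving_sub_vec x).quasiMeasurePreserving.ae_eq_comp
      (Lp.coeFn_compMeasurePreserving g (measurePreserving_sub_vec (-x)))).trans ?_
    refine ae_of_all _ fun y => ?_
    simp
  conv_lhs => rw [← h1]
  exact (Lp.compMeasurePreservingₗᵢ ℂ _ (measurePreserving_sub_vec x)).inner_map_map f _

/-- Restriction, from `L²(ℝᵈ, k)` to `L²(A, k)`. -/
def restrictL2 (A : PModule d) (f : Lp k 2 (volume : Measure (Fin d → ℝ))) : A.L2 k :=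
  ((Lp.memLp f).restrict A.carrier).toLp

theorem coeFn_restrictL2 (A : PModule d) (f : Lp k 2 (volume : Measure (Fin d → ℝ))) :
    restrictL2 A f =ᵐ[volume.restrict A.carrier] f :=
  MemLp.coeFn_toLp ((Lp.memLp f).restrict A.carrier)

theorem continuous_restrictL2 (A : PModule d) :
    Continuous (restrictL2 A : Lp k 2 (volume : Measure (Fin d → ℝ)) → A.L2 k) :=
  (LpToLpRestrictCLM (Fin d → ℝ) k ℂ volume 2 A.carrier).continuous

theorem inner_restrict (A : PModule d) (f : Lp k 2 (volume : Measure (Fin d → ℝ)))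
    (g : A.L2 k) :
    ⟪restrictL2 A f, g⟫_ℂ = ⟪f, extendZero A g⟫_ℂ := by
  rw [L2.inner_def, L2.inner_def]
  have h1 : (fun y => ⟪f y, extendZero A g y⟫_ℂ) =ᵐ[volume]
      A.carrier.indicator (fun y => ⟪f y, g y⟫_ℂ) := by
    filter_upwards [coeFn_extendZero A g] with y hy
    rw [hy]
    by_cases h : y ∈ A.carrier
    · rw [Set.indicator_of_mem h, Set.indicator_of_mem h]
    · rw [Set.indicator_of_notMem h, Set.indicator_of_notMem h, inner_zero_right]
  rw [integral_congr_ae h1, integral_indicator A.measurableSet]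
  refine integral_congr_ae ?_
  filter_upwards [coeFn_restrictL2 A f] with y hy
  rw [hy]

theorem shift_eq (A : PModule d) (x : Orthant d) (f : A.L2 k) :
    shift A x f = restrictL2 A
      (translate x.toVec (extendZero A f)) := by
  apply Lp.ext
  refine (coeFn_shift A x f).trans (EventuallyEq.trans ?_ (coeFn_restrictL2 A _).symm)
  refine ae_restrict_of_ae ?_
  refine EventuallyEq.trans ?_
    (Lp.coeFn_compMeasurePreserving _ (measurePreserving_sub_vec x.toVec)).symm
  exact ((measurePreserving_sub_vec x.toVec).quasiMeasurePreserving.ae_eq_comp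
    (coeFn_extendZero A f)).symm

theorem adjoint_shift [CompleteSpace k] (A : PModule d) (x : Orthant d) (f : A.L2 k) :
    ContinuousLinearMap.adjoint (shift A x).toContinuousLinearMap f =
      restrictL2 A
        (translate (-x.toVec) (extendZero A f)) := by
  refine ext_inner_left ℂ fun g => ?_
  rw [ContinuousLinearMap.adjoint_inner_right]
  change ⟪shift A x g, f⟫_ℂ = _
  rw [shift_eq, inner_restrict, inner_translate, ← inner_conj_symm, ← inner_restrict,
    inner_conj_symm]

variable (k) in
/-- The isometric representation `S^A` of `ℝ₊ᵈ` on `L²(A, k)` by shifts. -/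
def shiftRep [CompleteSpace k] (A : PModule d) : IsometricRep (Orthant d) (A.L2 k) where
  toFun x := shift A x
  map_add := shift_add A
  continuous f := by
    simp only [shift_eq]
    exact (continuous_restrictL2 A).comp
      ((continuous_translate _).comp Orthant.continuous_toVec)
  continuous_adjoint f := by
    simp only [adjoint_shift]
    exact (continuous_restrictL2 A).comp
      ((continuous_translate _).comp Orthant.continuous_toVec.neg)

/-- The module `×ᵢ R i`, where each factor `R i` is `ℝ` or `ℝ₊`. -/
def prodModule (R : Fin d → Set ℝ) (hR : ∀ i, R i = Set.univ ∨ R i = Set.Ici 0) : PModule d where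
  carrier := Set.univ.pi R
  isClosed := isClosed_set_pi fun i _ => by
    rcases hR i with h | h <;> rw [h]
    · exact isClosed_univ
    · exact isClosed_Ici
  nonempty := ⟨0, fun i _ => by
    rcases hR i with h | h <;> rw [h]
    · exact Set.mem_univ _
    · exact le_refl (0 : ℝ)⟩
  add_mem := by
    intro y hy x i hi
    have h0 := hy i hi
    rcases hR i with h | h <;> rw [h] at h0 ⊢
    · exact Set.mem_univ _
    · exact add_nonneg h0 (x i).2

/-- The module `A_T^{(a,b)} = [a, ∞) × [b, ∞) ∪ [0, ∞) × [0, b)` in `ℝ²`, for `a < 0 < b`. -/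
def tModule (a b : ℝ) (ha : a < 0) (hb : 0 < b) : PModule 2 where
  carrier := {y | y 0 ∈ Set.Ici a ∧ y 1 ∈ Set.Ici b} ∪ {y | y 0 ∈ Set.Ici 0 ∧ y 1 ∈ Set.Ico 0 b}
  isClosed := by
    have h : ({y | y 0 ∈ Set.Ici a ∧ y 1 ∈ Set.Ici b} ∪
        {y | y 0 ∈ Set.Ici 0 ∧ y 1 ∈ Set.Ico 0 b} : Set (Fin 2 → ℝ)) =
        {y | a ≤ y 0 ∧ b ≤ y 1} ∪ {y | 0 ≤ y 0 ∧ 0 ≤ y 1} := by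
      ext y
      simp only [Set.mem_union, Set.mem_ofPred_eq, Set.mem_Ici, Set.mem_Ico]
      constructor
      · rintro (h | h)
        · exact Or.inl h
        · exact Or.inr ⟨h.1, h.2.1⟩
      · rintro (h | h)
        · exact Or.inl h
        · rcases lt_or_ge (y 1) b with h' | h'
          · exact Or.inr ⟨h.1, h.2, h'⟩
          · exact Or.inl ⟨ha.le.trans h.1, h'⟩
    rw [h]
    exact ((isClosed_le continuous_const (continuous_apply 0)).inter
      (isClosed_le continuous_const (continuous_apply 1))).union
      ((isClosed_le continuous_const (continuous_apply 0)).inter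
      (isClosed_le continuous_const (continuous_apply 1)))
  nonempty := ⟨0, Or.inr ⟨le_refl (0 : ℝ), le_refl (0 : ℝ), hb⟩⟩
  add_mem := by
    intro y hy x
    have h0 : (0 : ℝ) ≤ x.toVec 0 := (x 0).2
    have h1 : (0 : ℝ) ≤ x.toVec 1 := (x 1).2
    simp only [Set.mem_union, Set.mem_ofPred_eq, Set.mem_Ici, Set.mem_Ico, Pi.add_apply] at hy ⊢
    rcases hy with h | h
    · left; constructor <;> linarith
    · rcases lt_or_ge (y 1 + x.toVec 1) b with h' | h'
      · right; refine ⟨?_, ?_, h'⟩ <;> linarith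
      · left; constructor <;> linarith

end Shift

end CCR

end

noncomputable section

namespace CCR

universe u

open MeasureTheory ContinuousLinearMap Filter Topology
open scoped NNReal ENNReal

/-! ### Fock cocycles: the common form of additive cocycles and normalised units. -/

section Cocycle

variable {P : Type*} [AddCommMonoid P] [TopologicalSpace P]
  {K : Type u} [NormedAddCommGroup K] [InnerProductSpace ℂ K] [CompleteSpace K]

/-! Additive cocycles and units are treated together. An additive cocycle `h` gives the vectors `ζ_x
= e(h_x)`; a unit `u` gives `ζ_x = u_x e(0) / ⟨e(0), u_x e(0)⟩`. In both cases `F_x(f) = ⟨ζ_x,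
e(f)⟩` satisfies `F_{x+y}(f) = F_x(f) F_y(V_x^* f)`, `F_x(0) = 1`, and `F_x` ignores the component
of its argument in the range of `V_x` (`IsFockCocycle`). It suffices that every such `F` is
identically `1`: then `exp ‖h_x‖² = 1` forces `h = 0`, and a unit must be its vacuum expectation
times `Γ(V_x)`. The vacuum expectation is a continuous multiplicative function on the orthant with
value `1` at `0`, hence an exponential; in particular it has no zeros, which justifies the division
(`cocycles_units_typeII0_of_fockCocycle_eq_one`).

Commutativity of the semigroup drives the triviality: expanding `F_{x+y} = F_{y+x}` at `V_y f` gives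
`F_x(V_y f) F_y(V_x^* V_y f) = F_x(f)` (`apply_shift_mul`). If `V_x^*` and `V_y` commute on `f`, the
second factor is `1`, so `F_x(V_y f) = F_x(f)`. Letting `y` go to infinity along a coordinate ray,
`V_y f` tends weakly to `0`, so `e(V_y f)` tends weakly to the vacuum and `F_x(f) = 1`
(`eq_one_of_tendsto`).

For a product module, `V_x^*` along one axis commutes with `V_y` along any other axis, and a second
axis exists since `d ≥ 2`. For `A_T` this commutation fails because of the missing corner, but it
holds on functions supported in the upper part or in the right half. The horizontal cocycle is shown
to be trivial by cutting at height `b` and shifting up by `b`; the vertical one follows by a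
horizontal shift. -/

/-- The adjoint of the isometry `V_x`. -/
def IsometricRep.adj (V : IsometricRep P K) (x : P) : K →L[ℂ] K :=
  adjoint (V.toFun x).toContinuousLinearMap

theorem IsometricRep.inner_adj_left (V : IsometricRep P K) (x : P) (a b : K) :
    ⟪V.adj x a, b⟫_ℂ = ⟪a, V.toFun x b⟫_ℂ :=
  adjoint_inner_left _ _ _

theorem IsometricRep.inner_adj_right (V : IsometricRep P K) (x : P) (a b : K) :
    ⟪a, V.adj x b⟫_ℂ = ⟪V.toFun x a, b⟫_ℂ :=
  adjoint_inner_right _ _ _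

theorem IsometricRep.adj_apply_self (V : IsometricRep P K) (x : P) (a : K) :
    V.adj x (V.toFun x a) = a :=
  adjoint_apply_self _ _

/-- A family of vectors in the Fock space whose coefficients `⟨ζ_x, e(u)⟩` form a multiplicative
cocycle of `V`, depending only on the component of `u` in `ker V_x^*`. -/
structure IsFockCocycle (V : IsometricRep P K) (ζ : P → Fock K) : Prop where
  map_add : ∀ x y u, ⟪ζ (x + y), expVec u⟫_ℂ = ⟪ζ x, expVec u⟫_ℂ * ⟪ζ y, expVec (V.adj x u)⟫_ℂ
  apply_zero : ∀ x, ⟪ζ x, expVec 0⟫_ℂ = 1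
  apply_add_range : ∀ x w v, ⟪ζ x, expVec (w + V.toFun x v)⟫_ℂ = ⟪ζ x, expVec w⟫_ℂ

/-- Exponentiation preserves weak convergence of bounded families: the norms `‖e(f_x)‖² = exp
‖f_x‖²` stay bounded, so testing against exponential vectors is enough. -/
theorem tendsto_inner_expVec {X : Type*} {l : Filter X} {f : X → K} {C : ℝ}
    (hf : ∀ x, ‖f x‖ ≤ C) (h : ∀ w, Tendsto (fun x => ⟪w, f x⟫_ℂ) l (𝓝 0)) (ζ : Fock K) :
    Tendsto (fun x => ⟪ζ, expVec (f x)⟫_ℂ) l (𝓝 ⟪ζ, expVec 0⟫_ℂ) := by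
  have h1 : Tendsto (fun x => ⟪expVec (f x), ζ⟫_ℂ) l (𝓝 ⟪expVec 0, ζ⟫_ℂ) := by
    refine isTotal_expVec.tendsto_right (C := Real.exp (C ^ 2)) (.of_forall fun x => ?_)
      (fun w => ?_) ζ
    · have h2 : ‖expVec (f x)‖ ^ 2 = Real.exp (‖f x‖ ^ 2) := by
        have := inner_expVec (f x) (f x)
        rw [inner_self_eq_norm_sq_to_K, inner_self_eq_norm_sq_to_K] at this
        rw [← Complex.ofReal_inj, Complex.ofReal_exp]
        push_cast
        exact this
      have h3 : Real.exp (‖f x‖ ^ 2) ≤ Real.exp (C ^ 2) := by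
        have := hf x
        gcongr
      have h4 : 1 ≤ Real.exp (C ^ 2) := Real.one_le_exp (by positivity)
      nlinarith [norm_nonneg (expVec (f x))]
    · simp only [inner_expVec, inner_zero_left]
      refine (Complex.continuous_exp.tendsto _).comp ?_
      have := (Complex.continuous_conj.tendsto _).comp (h w)
      simpa only [Function.comp_def, inner_conj_symm, _root_.map_zero] using this
  have := (Complex.continuous_conj.tendsto _).comp h1
  simpa only [Function.comp_def, inner_conj_symm] using this

namespace IsFockCocycle

variable {V : IsometricRep P K} {ζ : P → Fock K}

theorem apply_range (hζ : IsFockCocycle V ζ) (x : P) (v : K) :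
    ⟪ζ x, expVec (V.toFun x v)⟫_ℂ = 1 := by
  rw [← zero_add (V.toFun x v), hζ.apply_add_range, hζ.apply_zero]

theorem comm (hζ : IsFockCocycle V ζ) (x y : P) (u : K) :
    ⟪ζ x, expVec u⟫_ℂ * ⟪ζ y, expVec (V.adj x u)⟫_ℂ =
      ⟪ζ y, expVec u⟫_ℂ * ⟪ζ x, expVec (V.adj y u)⟫_ℂ := by
  rw [← hζ.map_add, ← hζ.map_add, add_comm]

/-- This is `comm` at `V_y v`, where the right-hand factor of `y` equals `1` and `V_y^* V_y = 1`. No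
commutation of `V_x^*` with `V_y` is needed. -/
theorem apply_shift_mul (hζ : IsFockCocycle V ζ) (x y : P) (v : K) :
    ⟪ζ x, expVec (V.toFun y v)⟫_ℂ * ⟪ζ y, expVec (V.adj x (V.toFun y v))⟫_ℂ =
      ⟪ζ x, expVec v⟫_ℂ := by
  rw [hζ.comm, hζ.apply_range, V.adj_apply_self, one_mul]

theorem apply_shift (hζ : IsFockCocycle V ζ) {x y : P} {v : K}
    (h : V.adj x (V.toFun y v) = V.toFun y (V.adj x v)) :
    ⟪ζ x, expVec (V.toFun y v)⟫_ℂ = ⟪ζ x, expVec v⟫_ℂ := by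
  have := hζ.apply_shift_mul x y v
  rwa [h, hζ.apply_range, mul_one] at this

theorem eq_one_of_tendsto (hζ : IsFockCocycle V ζ) {x : P} {v : K} {y : ℕ → P}
    (h : ∀ n, ⟪ζ x, expVec (V.toFun (y n) v)⟫_ℂ = ⟪ζ x, expVec v⟫_ℂ)
    (hw : ∀ w, Tendsto (fun n => ⟪w, V.toFun (y n) v⟫_ℂ) atTop (𝓝 0)) :
    ⟪ζ x, expVec v⟫_ℂ = 1 := by
  have h1 := tendsto_inner_expVec (C := ‖v‖) (fun n => ((V.toFun (y n)).norm_map v).le) hw (ζ x)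
  simp only [h, hζ.apply_zero] at h1
  exact tendsto_nhds_unique tendsto_const_nhds h1

end IsFockCocycle

/-- The coefficient is `exp ⟨h_x, u⟩`, so the additive law becomes multiplicative and `h_x ∈ ker
V_x^*` gives the invariance under the range of `V_x`. -/
theorem IsAdditiveCocycle.isFockCocycle {V : IsometricRep P K} {h : P → K}
    (hh : IsAdditiveCocycle V h) : IsFockCocycle V (fun x => expVec (h x)) where
  map_add x y u := by
    rw [inner_expVec, inner_expVec, inner_expVec, ← Complex.exp_add, hh.map_add, inner_add_left,
      V.inner_adj_right]
  apply_zero x := by simp [inner_expVec]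
  apply_add_range x w v := by
    have h1 : V.adj x (h x) = 0 := hh.mem_ker x
    rw [inner_expVec, inner_expVec, inner_add_right, ← V.inner_adj_left, h1, inner_zero_left,
      add_zero]

theorem isAdditiveCocycle_zero (V : IsometricRep P K) : IsAdditiveCocycle V 0 where
  continuous := continuous_zero
  mem_ker _ := map_zero _
  map_add x y := by simp

theorem setOf_isAdditiveCocycle_eq {V : IsometricRep P K}
    (hV : ∀ ζ, IsFockCocycle V ζ → ∀ x u, ⟪ζ x, expVec u⟫_ℂ = 1) :
    {h | IsAdditiveCocycle V h} = {0} := by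
  ext h
  constructor
  · intro hh
    have h1 : ∀ x, expVec (h x) = expVec (0 : K) := fun x =>
      isTotal_expVec.ext_vec fun u => by
        rw [← inner_conj_symm, hV _ hh.isFockCocycle x u, inner_expVec]
        simp
    funext x
    -- Testing against `h_x` itself gives `exp ‖h_x‖² = 1`.
    have h2 := hV _ hh.isFockCocycle x (h x)
    rw [inner_expVec, inner_self_eq_norm_sq_to_K] at h2
    have h3 : Real.exp (‖h x‖ ^ 2) = 1 := by
      rw [← Complex.ofReal_inj, Complex.ofReal_exp]
      push_cast
      exact h2
    simpa using h3
  · rintro rfl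
    exact isAdditiveCocycle_zero V

/-! ### Units of a CCR flow and their vacuum expectations. -/

section Units

variable {V : IsometricRep P K} {u : P → Fock K →L[ℂ] Fock K}

/-- A unit is determined by its values on the vacuum. With the rank-one operator `T = |η⟩⟨e(0)|`,
intertwining gives `u_x η = α_x(T) u_x e(0)`; moving `α_x(T)` to the other side, `α_x(T^*) = 1 ⊗
|e(0)⟩⟨η|` sends `e(w) ⊗ e(v)` to a multiple of `e(w) ⊗ e(0)`. -/
theorem IsUnitOf.inner_apply (hu : IsUnitOf (ccrFlow V) u) (x : P) {w : K} (hw : V.adj x w = 0)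
    (v : K) (η : Fock K) :
    ⟪expVec (w + V.toFun x v), u x η⟫_ℂ = ⟪expVec v, η⟫_ℂ * ⟪expVec w, u x (expVec 0)⟫_ℂ := by
  let T : Fock K →L[ℂ] Fock K := (innerSL ℂ (expVec (0 : K))).smulRight η
  let S : Fock K →L[ℂ] Fock K := (innerSL ℂ η).smulRight (expVec 0)
  have hTS : star T = S := by
    rw [star_eq_adjoint]
    symm
    rw [eq_adjoint_iff]
    intro a b
    simp only [T, S, smulRight_apply, innerSL_apply_apply, inner_smul_left, inner_smul_right,
      inner_conj_symm]
    ring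
  have hT : T (expVec 0) = η := by
    simp only [T, smulRight_apply, innerSL_apply_apply, inner_expVec, inner_zero_left,
      Complex.exp_zero, one_smul]
  have h1 : u x η = (ccrFlow V).toFun x T (u x (expVec 0)) := by
    have := congrArg (fun A : Fock K →L[ℂ] Fock K => A (expVec 0)) (hu.intertwine x T)
    simpa only [comp_apply, hT] using this.symm
  have h2 : (ccrFlow V).toFun x S (expVec (w + V.toFun x v)) = ⟪η, expVec v⟫_ℂ • expVec w := by
    have h3 := fockSplit_htmul (V.toFun x) ⟨w, hw⟩ v
    have h4 := fockSplit_htmul (V.toFun x) ⟨w, hw⟩ 0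
    simp only [_root_.map_zero, add_zero] at h3 h4
    change ccrEndo (V.toFun x) S _ = _
    rw [← h3, ccrEndo_apply_fockSplit, idTensor_htmul, ← h4, ← map_smul]
    congr 1
    simp [S, htmul]
  rw [h1, ← adjoint_inner_left, ← star_eq_adjoint, ← map_star, hTS, h2, inner_smul_left,
    inner_conj_symm]

theorem IsometricRep.adj_sub (V : IsometricRep P K) (x : P) (a : K) :
    V.adj x (a - V.toFun x (V.adj x a)) = 0 := by
  rw [map_sub, V.adj_apply_self, sub_self]

theorem IsUnitOf.inner_apply' (hu : IsUnitOf (ccrFlow V) u) (x : P) (a : K) (η : Fock K) :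
    ⟪expVec a, u x η⟫_ℂ = ⟪expVec (V.adj x a), η⟫_ℂ * ⟪expVec a, u x (expVec 0)⟫_ℂ := by
  have h1 := hu.inner_apply x (V.adj_sub x a) (V.adj x a)
  simp only [sub_add_cancel] at h1
  rw [h1 η, h1 (expVec 0), inner_expVec (V.adj x a) 0, inner_zero_right, Complex.exp_zero, one_mul]

/-- The vacuum expectation of a family of operators on the Fock space. -/
def vacuumExp (u : P → Fock K →L[ℂ] Fock K) (x : P) : ℂ := ⟪expVec 0, u x (expVec 0)⟫_ℂ

theorem IsUnitOf.vacuumExp_add (hu : IsUnitOf (ccrFlow V) u) (x y : P) :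
    vacuumExp u (x + y) = vacuumExp u x * vacuumExp u y := by
  have := hu.inner_apply' x 0 (u y (expVec 0))
  rw [vacuumExp, hu.map_add, comp_apply, this, map_zero, mul_comm]
  rfl

theorem IsUnitOf.continuous_vacuumExp (hu : IsUnitOf (ccrFlow V) u) :
    Continuous (vacuumExp u) :=
  continuous_const.inner (hu.continuous _)

/-- Since `V_0 = 1`, the operator `u_0` is a scalar, and that scalar is idempotent. The value `0` is
excluded because `u_x = u_x u_0` would then vanish for all `x`. -/
theorem IsUnitOf.vacuumExp_zero (hu : IsUnitOf (ccrFlow V) u) : vacuumExp u 0 = 1 := by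
  have h1 : u 0 = vacuumExp u 0 • 1 := by
    refine isTotal_expVec.ext fun b => isTotal_expVec.ext_vec fun a => ?_
    have := hu.inner_apply 0 (w := 0) (map_zero _) a (expVec b)
    rw [V.map_zero, zero_add] at this
    rw [this, smul_apply, inner_smul_right, mul_comm]
    rfl
  by_contra hc
  have h2 := hu.vacuumExp_add 0 0
  rw [add_zero] at h2
  have h3 : vacuumExp u 0 = 0 := by
    by_contra h0
    exact hc (mul_left_cancel₀ h0 (by rw [← h2, mul_one]))
  obtain ⟨x, hx⟩ := hu.exists_ne_zero
  apply hx
  rw [← add_zero x, hu.map_add, h1, h3, zero_smul, comp_zero]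

theorem IsUnitOf.isFockCocycle (hu : IsUnitOf (ccrFlow V) u) (h0 : ∀ x, vacuumExp u x ≠ 0) :
    IsFockCocycle V (fun x => (vacuumExp u x)⁻¹ • u x (expVec 0)) := by
  have hF : ∀ x a, ⟪(vacuumExp u x)⁻¹ • u x (expVec 0), expVec a⟫_ℂ =
      starRingEnd ℂ ((vacuumExp u x)⁻¹ * ⟪expVec a, u x (expVec 0)⟫_ℂ) := by
    intro x a
    rw [map_mul, inner_conj_symm, inner_smul_left]
  refine ⟨fun x y a => ?_, fun x => ?_, fun x a v => ?_⟩
  · rw [hF, hF, hF, ← map_mul, hu.vacuumExp_add, hu.map_add, comp_apply, hu.inner_apply']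
    congr 1
    rw [mul_inv]
    ring
  · rw [hF, ← vacuumExp, inv_mul_cancel₀ (h0 x), map_one]
  · rw [hF, hF]
    have h1 := hu.inner_apply x (V.adj_sub x a) (V.adj x a + v) (expVec 0)
    have h2 := hu.inner_apply x (V.adj_sub x a) (V.adj x a) (expVec 0)
    simp only [_root_.map_add, ← add_assoc, sub_add_cancel, inner_expVec (K := K) _ 0,
      inner_zero_right] at h1 h2
    rw [h1, h2]

/-- Equivalently, `Γ(V_x)^* e(a) = e(V_x^* a)`. -/
theorem secondQuant_adj_expVec (V : IsometricRep P K) (x : P) (a : K) (η : Fock K) :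
    ⟪expVec a, secondQuant (V.toFun x) η⟫_ℂ = ⟪expVec (V.adj x a), η⟫_ℂ := by
  rw [← LinearIsometry.coe_toContinuousLinearMap, ← adjoint_inner_left]
  congr 1
  refine isTotal_expVec.ext_vec fun b => ?_
  rw [adjoint_inner_right, LinearIsometry.coe_toContinuousLinearMap, secondQuant_expVec,
    inner_expVec, inner_expVec, V.inner_adj_right]

theorem continuous_secondQuant (V : IsometricRep P K) (η : Fock K) :
    Continuous fun x => secondQuant (V.toFun x) η := by
  -- The operators are all isometric, so an `ε/3` argument shows that the vectors with continuous
  -- orbit form a closed set; it then suffices to treat the span of the exponential vectors.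
  have hcl : IsClosed {η : Fock K | Continuous fun x => secondQuant (V.toFun x) η} := by
    refine isClosed_of_closure_subset fun η hη => ?_
    rw [Metric.mem_closure_iff] at hη
    refine continuous_iff_continuousAt.2 fun x => Metric.tendsto_nhds.2 fun ε hε => ?_
    obtain ⟨η', h', hd⟩ := hη (ε / 3) (by positivity)
    filter_upwards [Metric.tendsto_nhds.1 (h'.tendsto x) (ε / 3) (by positivity)] with y hy
    have h1 := dist_triangle4 (secondQuant (V.toFun y) η) (secondQuant (V.toFun y) η')
      (secondQuant (V.toFun x) η') (secondQuant (V.toFun x) η)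
    rw [LinearIsometry.dist_map, LinearIsometry.dist_map, dist_comm η' η] at h1
    linarith
  refine hcl.closure_subset_iff.2 (fun ξ hξ => ?_) (isTotal_expVec η)
  induction hξ using Submodule.span_induction with
  | mem _ h =>
    obtain ⟨v, rfl⟩ := h
    change Continuous fun x => secondQuant (V.toFun x) (expVec v)
    simp only [secondQuant_expVec]
    exact continuous_expVec.comp (V.continuous v)
  | zero =>
    change Continuous fun x => secondQuant (V.toFun x) 0
    simpa only [_root_.map_zero] using continuous_const
  | add a b _ _ ha hb =>
    change Continuous fun x => secondQuant (V.toFun x) (a + b)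
    simp only [_root_.map_add]
    exact Continuous.add ha hb
  | smul c a _ ha =>
    change Continuous fun x => secondQuant (V.toFun x) (c • a)
    simp only [map_smul]
    exact Continuous.const_smul ha c

/-- The second quantization of `V`, multiplied by a continuous character, is a unit. -/
theorem isUnitOf_smul_secondQuant (V : IsometricRep P K) {c : P → ℂ} (hc : Continuous c)
    (h0 : c 0 = 1) (hadd : ∀ x y, c (x + y) = c x * c y) :
    IsUnitOf (ccrFlow V) (fun x => c x • (secondQuant (V.toFun x)).toContinuousLinearMap) where
  continuous ξ := hc.smul (continuous_secondQuant V ξ)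
  intertwine x T := by
    refine isTotal_expVec.ext fun b => isTotal_expVec.ext_vec fun a => ?_
    change ⟪expVec a, ccrEndo (V.toFun x) T (c x • secondQuant (V.toFun x) (expVec b))⟫_ℂ =
      ⟪expVec a, c x • secondQuant (V.toFun x) (T (expVec b))⟫_ℂ
    rw [map_smul, inner_smul_right, inner_smul_right, secondQuant_adj_expVec, secondQuant_expVec,
      inner_ccrEndo, adjoint_apply_self]
    change _ * (Complex.exp (⟪a, V.toFun x b⟫_ℂ - ⟪V.adj x a, b⟫_ℂ) * _) = _
    rw [V.inner_adj_left, sub_self, Complex.exp_zero, one_mul]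
    rfl
  map_add x y := by
    refine isTotal_expVec.ext fun b => ?_
    change c (x + y) • secondQuant (V.toFun (x + y)) (expVec b) =
      c x • secondQuant (V.toFun x) (c y • secondQuant (V.toFun y) (expVec b))
    rw [map_smul, secondQuant_expVec, secondQuant_expVec, secondQuant_expVec, V.map_add, smul_smul,
      hadd]
  exists_ne_zero := by
    refine ⟨0, fun h => ?_⟩
    have h1 := congrArg (fun A : Fock K →L[ℂ] Fock K => ⟪expVec 0, A (expVec 0)⟫_ℂ) h
    change ⟪expVec 0, c 0 • secondQuant (V.toFun 0) (expVec 0)⟫_ℂ = ⟪expVec 0, 0⟫_ℂ at h1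
    rw [h0, one_smul, secondQuant_expVec, inner_expVec] at h1
    simp at h1

/-- Triviality of the cocycle makes `⟨e(a), u_x e(0)⟩` independent of `a`; `inner_apply'` then
leaves exactly the matrix coefficients of `Γ(V_x)`. -/
theorem IsUnitOf.eq_smul_secondQuant (hu : IsUnitOf (ccrFlow V) u) (h0 : ∀ x, vacuumExp u x ≠ 0)
    (hV : ∀ ζ, IsFockCocycle V ζ → ∀ x u, ⟪ζ x, expVec u⟫_ℂ = 1) (x : P) :
    u x = vacuumExp u x • (secondQuant (V.toFun x)).toContinuousLinearMap := by
  refine isTotal_expVec.ext fun b => isTotal_expVec.ext_vec fun a => ?_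
  have h1 := hV _ (hu.isFockCocycle h0) x a
  rw [inner_smul_left, ← inner_conj_symm, ← map_mul, ← map_one (starRingEnd ℂ)] at h1
  have h2 := (starRingEnd ℂ).injective h1
  rw [inv_mul_eq_one₀ (h0 x)] at h2
  rw [hu.inner_apply', ← h2, smul_apply, inner_smul_right, LinearIsometry.coe_toContinuousLinearMap,
    secondQuant_adj_expVec, mul_comm]

end Units

end Cocycle

/-! ### Continuous characters of the orthant, and reduction to trivial Fock cocycles. -/

section Character

/-- Integrating the functional equation over `[0, δ]` expresses `f` through its primitive, so a
continuous solution is differentiable and satisfies `f' = μ f`. -/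
theorem exists_exp_of_continuous_of_map_add {f : ℝ≥0 → ℂ} (hf : Continuous f) (h0 : f 0 = 1)
    (hadd : ∀ s t, f (s + t) = f s * f t) : ∃ μ : ℂ, ∀ t : ℝ≥0, f t = Complex.exp (t * μ) := by
  -- This extension is constant on the negative half-line and continuous, so its primitive is
  -- differentiable on all of `ℝ`, including at `0`.
  set g : ℝ → ℂ := fun t => f t.toNNReal with hg
  have hgc : Continuous g := hf.comp continuous_real_toNNReal
  have hgadd : ∀ s t, 0 ≤ s → 0 ≤ t → g (s + t) = g s * g t := fun s t hs ht => by
    simp only [hg, Real.toNNReal_add hs ht, hadd]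
  have hg0 : g 0 = 1 := by simp [hg, h0]
  set J : ℝ → ℂ := fun t => ∫ s in (0 : ℝ)..t, g s with hJ
  have hJd : ∀ t, HasDerivAt J (g t) t := fun t => (hgc.integral_hasStrictDerivAt 0 t).hasDerivAt
  -- `J` vanishes at `0` with derivative `g 0 = 1`, so it has no other zero close to `0`.
  obtain ⟨δ, hδ0, hδ⟩ : ∃ δ : ℝ, J δ ≠ 0 ∧ 0 < δ := by
    have h1 : ∀ᶠ z in 𝓝[≠] (0 : ℝ), J z ≠ 0 :=
      (hJd 0).eventually_ne (by rw [hg0]; exact one_ne_zero)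
    have h2 : ∀ᶠ z in 𝓝[>] (0 : ℝ), J z ≠ 0 :=
      h1.filter_mono (nhdsWithin_mono _ fun z hz => ne_of_gt hz)
    exact (h2.and self_mem_nhdsWithin).exists
  have hstep : ∀ t, 0 ≤ t → (J (t + δ) - J t) / J δ = g t := by
    intro t ht
    rw [div_eq_iff hδ0, hJ]
    simp only
    rw [intervalIntegral.integral_interval_sub_left (hgc.intervalIntegrable _ _)
      (hgc.intervalIntegrable _ _), ← intervalIntegral.integral_const_mul]
    have h1 := intervalIntegral.integral_comp_add_left (a := 0) (b := δ) g t
    rw [add_zero] at h1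
    rw [← h1]
    refine intervalIntegral.integral_congr fun s hs => ?_
    rw [Set.uIcc_of_le hδ.le] at hs
    exact hgadd t s ht hs.1
  -- The formula in `hstep` has derivative `(g (t + δ) - g t) / J δ = μ g(t)`, so `g(t) exp(-tμ)`,
  -- in the smooth form `q`, is constant.
  set μ : ℂ := (g δ - 1) / J δ with hμ
  set q : ℝ → ℂ := fun t => (J (t + δ) - J t) / J δ * Complex.exp (-(t * μ)) with hq
  have hqd : ∀ t, 0 ≤ t → HasDerivAt q 0 t := by
    intro t ht
    have h1 : HasDerivAt (fun t => (J (t + δ) - J t) / J δ) ((g (t + δ) - g t) / J δ) t :=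
      (((hJd (t + δ)).comp_add_const t δ).sub (hJd t)).div_const _
    have h2 : HasDerivAt (fun t : ℝ => Complex.exp (-(t * μ)))
        (Complex.exp (-(t * μ)) * (-(1 * μ))) t :=
      (((Complex.ofRealCLM.hasDerivAt (x := t)).mul_const μ).neg).cexp
    refine (h1.mul h2).congr_deriv ?_
    rw [hstep t ht, hgadd t δ ht hδ.le, hμ]
    ring
  refine ⟨μ, fun t => ?_⟩
  have h3 := constant_of_has_deriv_right_zero (f := q) (a := 0) (b := t)
    (fun s hs => (hqd s hs.1).continuousAt.continuousWithinAt)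
    (fun s hs => (hqd s hs.1).hasDerivWithinAt) t ⟨t.2, le_rfl⟩
  simp only [hq] at h3
  rw [hstep t t.2, hstep 0 le_rfl, hg0] at h3
  simp only [Complex.ofReal_zero, zero_mul, neg_zero, Complex.exp_zero, mul_one] at h3
  rw [Complex.exp_neg, mul_inv_eq_one₀ (Complex.exp_ne_zero _)] at h3
  simpa [hg] using h3

theorem Orthant.exists_exp_of_continuous_of_map_add {d : ℕ} {c : Orthant d → ℂ} (hc : Continuous c)
    (h0 : c 0 = 1) (hadd : ∀ x y, c (x + y) = c x * c y) :
    ∃ μ : Fin d → ℂ, ∀ x, c x = Complex.exp (∑ i, (x i : ℂ) * μ i) := by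
  have h1 : ∀ i, ∃ μ : ℂ, ∀ t : ℝ≥0, c (Pi.single i t) = Complex.exp (t * μ) := fun i =>
    CCR.exists_exp_of_continuous_of_map_add (f := fun t => c (Pi.single i t))
      (hc.comp (continuous_single (A := fun _ : Fin d => ℝ≥0) i)) (by simpa using h0)
      (fun s t => by rw [Pi.single_add, hadd])
  choose μ hμ using h1
  refine ⟨μ, fun x => ?_⟩
  have h2 : ∀ s : Finset (Fin d),
      c (∑ i ∈ s, Pi.single i (x i)) = ∏ i ∈ s, c (Pi.single i (x i)) := by
    intro s
    induction s using Finset.induction_on with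
    | empty => simpa using h0
    | insert i s hi ih => rw [Finset.sum_insert hi, Finset.prod_insert hi, hadd, ih]
  have h3 := h2 Finset.univ
  rw [Finset.univ_sum_single] at h3
  rw [h3, Complex.exp_sum]
  exact Finset.prod_congr rfl fun i _ => hμ i (x i)

theorem Orthant.continuous_exp {d : ℕ} (μ : Fin d → ℂ) :
    Continuous fun x : Orthant d => Complex.exp (∑ i, (x i : ℂ) * μ i) := by
  refine Complex.continuous_exp.comp (continuous_finsetSum _ fun i _ => ?_)
  exact (Complex.continuous_ofReal.comp
    (NNReal.continuous_coe.comp (continuous_apply i))).mul continuous_const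

theorem Orthant.exp_add {d : ℕ} (μ : Fin d → ℂ) (x y : Orthant d) :
    Complex.exp (∑ i, ((x + y) i : ℂ) * μ i) =
      Complex.exp (∑ i, (x i : ℂ) * μ i) * Complex.exp (∑ i, (y i : ℂ) * μ i) := by
  rw [← Complex.exp_add, ← Finset.sum_add_distrib]
  congr 1
  refine Finset.sum_congr rfl fun i _ => ?_
  rw [Pi.add_apply]
  push_cast
  ring

variable {d : ℕ} {K : Type u} [NormedAddCommGroup K] [InnerProductSpace ℂ K] [CompleteSpace K]

/-- If all Fock cocycles are trivial, then so are the additive cocycles, and the units are the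
second quantizations up to characters. -/
theorem cocycles_units_typeII0_of_fockCocycle_eq_one {V : IsometricRep (Orthant d) K}
    (hV : ∀ ζ, IsFockCocycle V ζ → ∀ x u, ⟪ζ x, expVec u⟫_ℂ = 1) :
    {h | IsAdditiveCocycle V h} = {0} ∧
    unitSet (ccrFlow V) = {u | ∃ μ : Fin d → ℂ, u = fun x => Complex.exp (∑ i, (x i : ℂ) * μ i) •
      (secondQuant (V.toFun x)).toContinuousLinearMap} ∧
    IsTypeII0 (ccrFlow V) := by
  have h1 : ∀ u ∈ unitSet (ccrFlow V), ∃ μ : Fin d → ℂ,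
      u = fun x => Complex.exp (∑ i, (x i : ℂ) * μ i) •
        (secondQuant (V.toFun x)).toContinuousLinearMap := by
    intro u (hu : IsUnitOf _ u)
    obtain ⟨μ, hμ⟩ := Orthant.exists_exp_of_continuous_of_map_add hu.continuous_vacuumExp
      hu.vacuumExp_zero hu.vacuumExp_add
    refine ⟨μ, funext fun x => ?_⟩
    rw [hu.eq_smul_secondQuant (fun x => by rw [hμ]; exact Complex.exp_ne_zero _) hV, hμ]
  have h2 : ∀ μ : Fin d → ℂ, IsUnitOf (ccrFlow V) (fun x => Complex.exp (∑ i, (x i : ℂ) * μ i) •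
        (secondQuant (V.toFun x)).toContinuousLinearMap) := fun μ =>
    isUnitOf_smul_secondQuant V (Orthant.continuous_exp μ) (by simp) (Orthant.exp_add μ)
  -- The reference unit for type II₀ is the one with `μ = 0`, that is, `Γ(V_x)` itself.
  refine ⟨setOf_isAdditiveCocycle_eq hV, Set.Subset.antisymm h1 ?_, _, h2 0, fun v hv => ?_⟩
  · rintro _ ⟨μ, rfl⟩
    exact h2 μ
  · obtain ⟨μ, rfl⟩ := h1 v hv
    refine ⟨fun x => Complex.exp (∑ i, (x i : ℂ) * μ i), fun x => ?_⟩
    simp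

/-- A Fock cocycle over the orthant is trivial if it is trivial on the coordinate rays. -/
theorem IsFockCocycle.eq_one_of_single {V : IsometricRep (Orthant d) K} {ζ : Orthant d → Fock K}
    (hζ : IsFockCocycle V ζ) (h : ∀ i s u, ⟪ζ (Pi.single i s), expVec u⟫_ℂ = 1)
    (x : Orthant d) (u : K) : ⟪ζ x, expVec u⟫_ℂ = 1 := by
  have h0 : ∀ u, ⟪ζ 0, expVec u⟫_ℂ = 1 := fun u => by
    have := hζ.apply_range 0 u
    rwa [V.map_zero] at this
  have h2 : ∀ (s : Finset (Fin d)) u, ⟪ζ (∑ i ∈ s, Pi.single i (x i)), expVec u⟫_ℂ = 1 := by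
    intro s
    induction s using Finset.induction_on with
    | empty => simpa using h0
    | insert i s hi ih => intro u; rw [Finset.sum_insert hi, hζ.map_add, ih, h, one_mul]
  have h3 := h2 Finset.univ u
  rwa [Finset.univ_sum_single] at h3

end Character

/-! ### Supports of functions in `L²(A, k)`, and weak decay of the shifts. -/

section ShiftSupport

variable {d : ℕ} {k : Type u} [NormedAddCommGroup k] [InnerProductSpace ℂ k] [CompleteSpace k]

/-- A representative of an element of `L²(A, k)` is arbitrary off `A`. Cutting it down by the
indicator of `A` gives a function determined almost everywhere on `ℝᵈ`, which can be translated; all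
computations below use this form. -/
theorem PModule.L2.ext_indicator (A : PModule d) {f g : A.L2 k}
    (h : A.carrier.indicator (f : (Fin d → ℝ) → k) =ᵐ[volume]
      A.carrier.indicator (g : (Fin d → ℝ) → k)) : f = g :=
  Lp.ext ((ae_eq_restrict_iff_indicator_ae_eq A.measurableSet).2 h)

theorem indicator_shift (A : PModule d) (x : Orthant d) (f : A.L2 k) :
    A.carrier.indicator ((shiftRep k A).toFun x f : (Fin d → ℝ) → k) =ᵐ[volume]
      fun y => A.carrier.indicator (f : (Fin d → ℝ) → k) (y - x.toVec) := by
  refine ((ae_eq_restrict_iff_indicator_ae_eq A.measurableSet).1 (coeFn_shift A x f)).trans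
    (ae_of_all _ fun y => ?_)
  rw [shiftFun_eq, Set.indicator_apply_eq_self]
  intro hy
  refine Set.indicator_of_notMem (fun h => hy ?_) _
  simpa using A.add_mem _ h x

theorem measurePreserving_add_vec (x : Fin d → ℝ) :
    MeasurePreserving (fun y : Fin d → ℝ => y + x) volume volume :=
  measurePreserving_add_right volume x

theorem indicator_adj (A : PModule d) (x : Orthant d) (f : A.L2 k) :
    A.carrier.indicator ((shiftRep k A).adj x f : (Fin d → ℝ) → k) =ᵐ[volume]
      A.carrier.indicator
        fun y => A.carrier.indicator (f : (Fin d → ℝ) → k) (y + x.toVec) := by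
  refine (ae_eq_restrict_iff_indicator_ae_eq A.measurableSet).1 ?_
  have h1 : (shiftRep k A).adj x f = restrictL2 A (translate (-x.toVec) (extendZero A f)) :=
    adjoint_shift A x f
  rw [h1]
  refine (coeFn_restrictL2 A _).trans (ae_restrict_of_ae ?_)
  refine (Lp.coeFn_compMeasurePreserving _ (measurePreserving_sub_vec (-x.toVec))).trans ?_
  refine ((measurePreserving_sub_vec (-x.toVec)).quasiMeasurePreserving.ae_eq_comp
    (coeFn_extendZero A f)).trans (ae_of_all _ fun y => ?_)
  simp

/-- The function `f` vanishes almost everywhere outside `B`. -/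
def SuppIn (A : PModule d) (B : Set (Fin d → ℝ)) (f : A.L2 k) : Prop :=
  ∀ᵐ y ∂(volume : Measure (Fin d → ℝ)),
    A.carrier.indicator (f : (Fin d → ℝ) → k) y ≠ 0 → y ∈ B

variable {A : PModule d} {B B' : Set (Fin d → ℝ)} {f : A.L2 k}

theorem SuppIn.mono (hf : SuppIn A B f) (h : ∀ y ∈ A.carrier, y ∈ B → y ∈ B') :
    SuppIn A B' f := by
  filter_upwards [hf] with y hy h0
  exact h y (Set.mem_of_indicator_ne_zero h0) (hy h0)

theorem suppIn_univ (f : A.L2 k) : SuppIn A Set.univ f := ae_of_all _ fun _ _ => trivial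

theorem SuppIn.eq_zero (hf : SuppIn A B f) (h : ∀ y ∈ A.carrier, y ∉ B) : f = 0 := by
  apply PModule.L2.ext_indicator
  have h0 : A.carrier.indicator ((0 : A.L2 k) : (Fin d → ℝ) → k) =ᵐ[volume]
      A.carrier.indicator 0 :=
    (ae_eq_restrict_iff_indicator_ae_eq A.measurableSet).1 (Lp.coeFn_zero _ _ _)
  filter_upwards [hf, h0] with y hy hy0
  rw [hy0]
  by_contra hne
  simp only [Set.indicator_zero'] at hne
  exact h y (Set.mem_of_indicator_ne_zero hne) (hy hne)

theorem SuppIn.shift (hf : SuppIn A B f) (x : Orthant d)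
    (h : ∀ y, y - x.toVec ∈ A.carrier → y - x.toVec ∈ B → y ∈ B') :
    SuppIn A B' ((shiftRep k A).toFun x f) := by
  filter_upwards [indicator_shift A x f,
    (measurePreserving_sub_vec x.toVec).quasiMeasurePreserving.ae hf] with y hy hy' h0
  rw [hy] at h0
  exact h y (Set.mem_of_indicator_ne_zero h0) (hy' h0)

theorem SuppIn.adj (hf : SuppIn A B f) (x : Orthant d)
    (h : ∀ y ∈ A.carrier, y + x.toVec ∈ B → y ∈ B') :
    SuppIn A B' ((shiftRep k A).adj x f) := by
  filter_upwards [indicator_adj A x f,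
    (measurePreserving_add_vec x.toVec).quasiMeasurePreserving.ae hf] with y hy hy' h0
  rw [hy] at h0
  have hA := Set.mem_of_indicator_ne_zero h0
  rw [Set.indicator_of_mem hA] at h0
  exact h y hA (hy' h0)

/-- If `f` is supported in `B`, then a shift and the adjoint of a shift commute on `f`, provided
that `B` avoids the points where they could differ. -/
theorem SuppIn.adj_shift_comm (hf : SuppIn A B f) (x z : Orthant d)
    (h : ∀ y ∈ A.carrier, y + x.toVec - z.toVec ∈ A.carrier → y + x.toVec - z.toVec ∈ B →
      y - z.toVec ∈ A.carrier) :
    (shiftRep k A).adj x ((shiftRep k A).toFun z f) =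
      (shiftRep k A).toFun z ((shiftRep k A).adj x f) := by
  apply PModule.L2.ext_indicator
  have e1 := (measurePreserving_add_vec x.toVec).quasiMeasurePreserving.ae_eq_comp
    (indicator_shift A z f)
  have e2 := (measurePreserving_sub_vec z.toVec).quasiMeasurePreserving.ae_eq_comp
    (indicator_adj A x f)
  have e3 := (measurePreserving_sub_vec (z.toVec - x.toVec)).quasiMeasurePreserving.ae hf
  filter_upwards [indicator_adj A x ((shiftRep k A).toFun z f),
    indicator_shift A z ((shiftRep k A).adj x f), e1, e2, e3] with y h1 h2 h3 h4 h5
  simp only [Function.comp_apply] at h3 h4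
  have hy : y - (z.toVec - x.toVec) = y + x.toVec - z.toVec := by abel
  have hy' : y - z.toVec + x.toVec = y + x.toVec - z.toVec := by abel
  rw [hy] at h5
  rw [h1, h2, h4]
  -- With `f` extended by zero, the two sides are `1_A(y) f(y+x-z)` and `1_A(y-z) f(y+x-z)`. They
  -- can differ only where `y ∈ A` and `y - z ∉ A`, and there `h` forces `f(y+x-z) = 0`.
  by_cases hA : y ∈ A.carrier
  · rw [Set.indicator_of_mem hA, h3]
    by_cases hz : y - z.toVec ∈ A.carrier
    · rw [Set.indicator_of_mem hz, hy']
    · rw [Set.indicator_of_notMem hz]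
      by_contra hne
      exact hz (h y hA (Set.mem_of_indicator_ne_zero hne) (h5 hne))
  · have hz : y - z.toVec ∉ A.carrier := fun hz => hA (by simpa using A.add_mem _ hz z)
    rw [Set.indicator_of_notMem hA, Set.indicator_of_notMem hz]

theorem exists_add_suppIn (hB : MeasurableSet B) (f : A.L2 k) :
    ∃ g g' : A.L2 k, f = g + g' ∧ SuppIn A B g ∧ SuppIn A Bᶜ g' := by
  have key : ∀ S : Set (Fin d → ℝ), ∀ hS : MeasurableSet S,
      A.carrier.indicator (((Lp.memLp f).indicator hS).toLp : (Fin d → ℝ) → k) =ᵐ[volume]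
        A.carrier.indicator (S.indicator (f : (Fin d → ℝ) → k)) := fun S hS =>
    (ae_eq_restrict_iff_indicator_ae_eq A.measurableSet).1 (MemLp.coeFn_toLp _)
  have hsupp : ∀ S : Set (Fin d → ℝ), ∀ hS : MeasurableSet S,
      SuppIn A S ((Lp.memLp f).indicator hS).toLp := fun S hS => by
    filter_upwards [key S hS] with y hy h0
    rw [hy] at h0
    have h1 := Set.mem_of_indicator_ne_zero h0
    rw [Set.indicator_of_mem h1] at h0
    exact Set.mem_of_indicator_ne_zero h0
  refine ⟨_, _, ?_, hsupp B hB, hsupp Bᶜ hB.compl⟩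
  rw [← MemLp.toLp_add]
  conv_lhs => rw [← Lp.toLp_coeFn f (Lp.memLp f)]
  congr 1
  exact (Set.indicator_self_add_compl B _).symm

theorem inner_eq_zero_of_suppIn {g : A.L2 k} (hf : SuppIn A B f) (hg : SuppIn A B' g)
    (h : ∀ y, y ∈ B → y ∉ B') : ⟪f, g⟫_ℂ = 0 := by
  rw [L2.inner_def, ← integral_indicator A.measurableSet]
  refine integral_eq_zero_of_ae ?_
  filter_upwards [hf, hg] with y h1 h2
  by_cases hy : y ∈ A.carrier
  · rw [Set.indicator_of_mem hy] at h1 h2 ⊢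
    by_cases hfy : f y = 0
    · simp [hfy]
    · by_cases hgy : g y = 0
      · simp [hgy]
      · exact absurd (h2 hgy) (h y (h1 hfy))
  · simp [Set.indicator_of_notMem hy]

/-- These are the test vectors for weak convergence: a long enough shift in direction `j` makes the
supports of two of them disjoint. -/
theorem isTotal_suppIn_slab (A : PModule d) (j : Fin d) :
    IsTotal (fun w : {w : A.L2 k // ∃ N : ℕ, SuppIn A {y | |y j| ≤ N} w} => (w : A.L2 k)) := by
  rw [IsTotal, Submodule.dense_iff_topologicalClosure_eq_top,
    Submodule.topologicalClosure_eq_top_iff, Submodule.eq_bot_iff]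
  intro f hf
  rw [Submodule.mem_orthogonal] at hf
  have h1 : ∀ N : ℕ, SuppIn A {y | |y j| ≤ N}ᶜ f := by
    intro N
    have hm : MeasurableSet {y : Fin d → ℝ | |y j| ≤ N} :=
      measurableSet_le ((measurable_pi_apply j).norm) measurable_const
    obtain ⟨g, g', hgg', hg, hg'⟩ := exists_add_suppIn hm f
    have h2 : ⟪g, f⟫_ℂ = 0 := hf _ (Submodule.subset_span ⟨⟨g, N, hg⟩, rfl⟩)
    rw [hgg', inner_add_right, inner_eq_zero_of_suppIn hg hg' (fun y hy hy' => hy' hy), add_zero,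
      inner_self_eq_zero] at h2
    rw [hgg', h2, zero_add]
    exact hg'
  have h3 : SuppIn A ∅ f := by
    filter_upwards [ae_all_iff.2 h1] with y hy h0
    obtain ⟨N, hN⟩ := exists_nat_ge |y j|
    exact hy N h0 hN
  exact h3.eq_zero (fun y _ h => h)

/-- The shifts along a coordinate ray tend weakly to zero. -/
theorem tendsto_inner_shift_single (A : PModule d) (j : Fin d) (f w : A.L2 k) :
    Tendsto (fun n : ℕ => ⟪w, (shiftRep k A).toFun (Pi.single j (n : ℝ≥0)) f⟫_ℂ) atTop (𝓝 0) := by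
  have h1 := (isTotal_suppIn_slab (k := k) A j).tendsto_inner (l := (atTop : Filter ℕ))
    (S := fun n => ((shiftRep k A).toFun (Pi.single j (n : ℝ≥0))).toContinuousLinearMap)
    (S₀ := 0) (C := 1) (.of_forall fun n => LinearIsometry.norm_toContinuousLinearMap_le _) ?_ w f
  · simpa using h1
  · rintro ⟨a, N, ha⟩ ⟨b, M, hb⟩
    rw [zero_apply, inner_zero_right]
    refine tendsto_const_nhds.congr' ?_
    -- The shifted support lies in `y j ≥ n - M`, which exceeds `N`.
    filter_upwards [eventually_gt_atTop (N + M)] with n hn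
    symm
    refine inner_eq_zero_of_suppIn ha (hb.shift (B' := {y | (N : ℝ) < y j}) _ ?_) ?_
    · intro y _ hy
      simp only [Set.mem_ofPred_eq, Orthant.toVec, Pi.sub_apply, Pi.single_eq_same] at hy ⊢
      have h2 := (abs_le.1 hy).1
      have h3 : (N + M : ℝ) < n := by exact_mod_cast hn
      push_cast at h2
      linarith
    · intro y hy hy'
      simp only [Set.mem_ofPred_eq] at hy hy'
      linarith [le_abs_self (y j)]

theorem Orthant.toVec_single_same (j : Fin d) (t : ℝ≥0) :
    Orthant.toVec (Pi.single j t) j = t := by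
  simp [Orthant.toVec]

theorem Orthant.toVec_single_of_ne {i j : Fin d} (h : i ≠ j) (t : ℝ≥0) :
    Orthant.toVec (Pi.single j t) i = 0 := by
  simp [Orthant.toVec, h]

/-- A Fock cocycle at `x` is trivial on the functions supported in a set where the adjoint of the
shift by `x` commutes with the shifts along a coordinate ray. -/
theorem IsFockCocycle.eq_one_of_suppIn {ζ : Orthant d → Fock (A.L2 k)}
    (hζ : IsFockCocycle (shiftRep k A) ζ) {x : Orthant d} (j : Fin d) (hf : SuppIn A B f)
    (h : ∀ (n : ℕ), ∀ y ∈ A.carrier,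
      y + x.toVec - Orthant.toVec (Pi.single j (n : ℝ≥0)) ∈ A.carrier →
      y + x.toVec - Orthant.toVec (Pi.single j (n : ℝ≥0)) ∈ B →
      y - Orthant.toVec (Pi.single j (n : ℝ≥0)) ∈ A.carrier) :
    ⟪ζ x, expVec f⟫_ℂ = 1 :=
  hζ.eq_one_of_tendsto (y := fun n : ℕ => Pi.single j (n : ℝ≥0))
    (fun n => hζ.apply_shift (hf.adj_shift_comm x _ (h n)))
    (tendsto_inner_shift_single A j f)

/-! ### Product modules and the module `A_T`. -/

theorem IsFockCocycle.prodModule_eq_one (hd : 2 ≤ d) {R : Fin d → Set ℝ}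
    (hR : ∀ i, R i = Set.univ ∨ R i = Set.Ici 0) {ζ : Orthant d → Fock ((prodModule R hR).L2 k)}
    (hζ : IsFockCocycle (shiftRep k (prodModule R hR)) ζ) (x : Orthant d)
    (f : (prodModule R hR).L2 k) : ⟪ζ x, expVec f⟫_ℂ = 1 := by
  refine hζ.eq_one_of_single (fun i s f => ?_) x f
  have : Nontrivial (Fin d) := Fin.nontrivial_iff_two_le.2 hd
  obtain ⟨j, hij⟩ := exists_ne i
  -- Membership is decided coordinatewise: the shift along `i` leaves coordinate `j` alone, and the
  -- shift along `j` leaves the other coordinates alone. Thus commutation holds without any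
  -- restriction on the support.
  refine hζ.eq_one_of_suppIn j (suppIn_univ f) fun n y hy hy' _ l _ => ?_
  have h1 := hy l trivial
  have h2 := hy' l trivial
  rcases eq_or_ne l j with rfl | hl
  · simpa [Orthant.toVec_single_of_ne hij] using h2
  · simpa [Orthant.toVec_single_of_ne hl] using h1

section TModule

variable {a b : ℝ} {ha : a < 0} {hb : 0 < b}

theorem mem_tModule {y : Fin 2 → ℝ} : y ∈ (tModule a b ha hb).carrier ↔
    (a ≤ y 0 ∧ b ≤ y 1) ∨ (0 ≤ y 0 ∧ 0 ≤ y 1) := by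
  change (a ≤ y 0 ∧ b ≤ y 1) ∨ (0 ≤ y 0 ∧ 0 ≤ y 1 ∧ y 1 < b) ↔ _
  constructor
  · rintro (h | h)
    · exact .inl h
    · exact .inr ⟨h.1, h.2.1⟩
  · rintro (h | h)
    · exact .inl h
    · rcases lt_or_ge (y 1) b with h' | h'
      · exact .inr ⟨h.1, h.2, h'⟩
      · exact .inl ⟨ha.le.trans h.1, h'⟩

variable {ζ : Orthant 2 → Fock ((tModule a b ha hb).L2 k)} {f : (tModule a b ha hb).L2 k}

theorem Orthant.single_coords (s : ℝ≥0) :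
    Orthant.toVec (Pi.single (0 : Fin 2) s) 0 = s ∧ Orthant.toVec (Pi.single (0 : Fin 2) s) 1 = 0 ∧
    Orthant.toVec (Pi.single (1 : Fin 2) s) 0 = 0 ∧ Orthant.toVec (Pi.single (1 : Fin 2) s) 1 = s :=
  ⟨toVec_single_same _ _, toVec_single_of_ne (by decide) _, toVec_single_of_ne (by decide) _,
    toVec_single_same _ _⟩

/-- A horizontal translation does not change the height, so all points involved stay in the quadrant
`[a, ∞) × [b, ∞)`. -/
theorem adj_shift_comm_of_suppIn_upper (hf : SuppIn (tModule a b ha hb) {y | b ≤ y 1} f)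
    (s t : ℝ≥0) :
    (shiftRep k (tModule a b ha hb)).adj (Pi.single 0 s)
        ((shiftRep k (tModule a b ha hb)).toFun (Pi.single 1 t) f) =
      (shiftRep k (tModule a b ha hb)).toFun (Pi.single 1 t)
        ((shiftRep k (tModule a b ha hb)).adj (Pi.single 0 s) f) := by
  obtain ⟨-, h2, -, -⟩ := Orthant.single_coords s
  obtain ⟨-, -, h3, h4⟩ := Orthant.single_coords t
  refine hf.adj_shift_comm _ _ fun y hy _ hy' => ?_
  have := s.2
  have := t.2
  simp only [mem_tModule, Set.mem_ofPred_eq, Pi.add_apply, Pi.sub_apply, h2, h3, h4] at hy hy' ⊢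
  left
  constructor
  · rcases hy with h | h <;> linarith
  · linarith

/-- The same argument with the axes exchanged, inside the quadrant `[0, ∞) × [0, ∞)`. -/
theorem adj_shift_comm_of_suppIn_right (hf : SuppIn (tModule a b ha hb) {y | 0 ≤ y 0} f)
    (s t : ℝ≥0) :
    (shiftRep k (tModule a b ha hb)).adj (Pi.single 1 t)
        ((shiftRep k (tModule a b ha hb)).toFun (Pi.single 0 s) f) =
      (shiftRep k (tModule a b ha hb)).toFun (Pi.single 0 s)
        ((shiftRep k (tModule a b ha hb)).adj (Pi.single 1 t) f) := by
  obtain ⟨h1, h2, -, -⟩ := Orthant.single_coords s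
  obtain ⟨-, -, h3, -⟩ := Orthant.single_coords t
  refine hf.adj_shift_comm _ _ fun y hy _ hy' => ?_
  have := s.2
  have := t.2
  simp only [mem_tModule, Set.mem_ofPred_eq, Pi.add_apply, Pi.sub_apply, h1, h2, h3] at hy hy' ⊢
  right
  constructor
  · linarith
  · rcases hy with h | h <;> linarith

theorem IsFockCocycle.tModule_eq_one_of_suppIn_upper
    (hζ : IsFockCocycle (shiftRep k (tModule a b ha hb)) ζ)
    (hf : SuppIn (tModule a b ha hb) {y | b ≤ y 1} f) (s : ℝ≥0) :
    ⟪ζ (Pi.single 0 s), expVec f⟫_ℂ = 1 :=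
  hζ.eq_one_of_tendsto (y := fun n : ℕ => Pi.single 1 (n : ℝ≥0))
    (fun n => hζ.apply_shift (adj_shift_comm_of_suppIn_upper hf s n))
    (tendsto_inner_shift_single _ 1 f)

theorem IsFockCocycle.tModule_eq_one_of_suppIn_right
    (hζ : IsFockCocycle (shiftRep k (tModule a b ha hb)) ζ)
    (hf : SuppIn (tModule a b ha hb) {y | 0 ≤ y 0} f) (t : ℝ≥0) :
    ⟪ζ (Pi.single 1 t), expVec f⟫_ℂ = 1 :=
  hζ.eq_one_of_tendsto (y := fun n : ℕ => Pi.single 0 (n : ℝ≥0))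
    (fun n => hζ.apply_shift (adj_shift_comm_of_suppIn_right hf n t))
    (tendsto_inner_shift_single _ 0 f)

/-- Below height `b` the module lies in the right half, so the vertical cocycle is trivial on `f`
and on its backward horizontal shift. Moving `f` down by `b` kills it, so `comm` for the steps `s`
and `b` leaves only the horizontal coefficient. -/
theorem IsFockCocycle.tModule_eq_one_of_suppIn_lower
    (hζ : IsFockCocycle (shiftRep k (tModule a b ha hb)) ζ)
    (hf : SuppIn (tModule a b ha hb) {y | b ≤ y 1}ᶜ f) (s : ℝ≥0) :
    ⟪ζ (Pi.single 0 s), expVec f⟫_ℂ = 1 := by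
  obtain ⟨-, h2, -, -⟩ := Orthant.single_coords s
  obtain ⟨-, -, -, h4⟩ := Orthant.single_coords b.toNNReal
  rw [Real.coe_toNNReal b hb.le] at h4
  have hr : SuppIn (tModule a b ha hb) {y | 0 ≤ y 0} f := by
    refine hf.mono fun y hy hyb => ?_
    rcases mem_tModule.1 hy with h | h
    · exact absurd h.2 hyb
    · exact h.1
  have hr' : SuppIn (tModule a b ha hb) {y | 0 ≤ y 0}
      ((shiftRep k (tModule a b ha hb)).adj (Pi.single 0 s) f) := by
    refine hf.adj _ fun y hy hyb => ?_
    rcases mem_tModule.1 hy with h | h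
    · refine absurd ?_ hyb
      simpa [h2] using h.2
    · exact h.1
  have h0 : (shiftRep k (tModule a b ha hb)).adj (Pi.single 1 b.toNNReal) f = 0 := by
    refine (hf.adj (B' := ∅) _ fun y hy hyb => hyb ?_).eq_zero fun _ _ h => h
    simp only [Set.mem_ofPred_eq, Pi.add_apply, h4]
    rcases mem_tModule.1 hy with h | h <;> linarith
  have := hζ.comm (Pi.single 0 s) (Pi.single 1 b.toNNReal) f
  rwa [hζ.tModule_eq_one_of_suppIn_right hr, hζ.tModule_eq_one_of_suppIn_right hr', h0,
    hζ.apply_zero, mul_one, mul_one] at this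

/-- The coefficients are not multiplicative in `f`, so the upper and lower cases cannot simply be
combined. Since `V_y f` for the vertical step `y` of length `b` lies in the upper part,
`apply_shift_mul` rewrites `F_x(f)` as `F_y(V_x^* V_y f)`. There the upper part of `f` contributes a
vector in the range of `V_y`, which `F_y` ignores, and what remains is `F_x` of the lower part. -/
theorem IsFockCocycle.tModule_single_zero_eq_one
    (hζ : IsFockCocycle (shiftRep k (tModule a b ha hb)) ζ) (s : ℝ≥0)
    (f : (tModule a b ha hb).L2 k) : ⟪ζ (Pi.single 0 s), expVec f⟫_ℂ = 1 := by
  obtain ⟨-, -, h3, h4⟩ := Orthant.single_coords b.toNNReal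
  rw [Real.coe_toNNReal b hb.le] at h4
  have hup : ∀ f, SuppIn (tModule a b ha hb) {y | b ≤ y 1}
      ((shiftRep k (tModule a b ha hb)).toFun (Pi.single 1 b.toNNReal) f) := fun f => by
    refine (suppIn_univ f).shift _ fun y hy _ => ?_
    have := mem_tModule.1 hy
    simp only [Pi.sub_apply, h3, h4] at this
    change b ≤ y 1
    rcases this with h | h <;> linarith
  have key : ∀ f, ⟪ζ (Pi.single 0 s), expVec f⟫_ℂ = ⟪ζ (Pi.single 1 b.toNNReal),
      expVec ((shiftRep k (tModule a b ha hb)).adj (Pi.single 0 s)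
        ((shiftRep k (tModule a b ha hb)).toFun (Pi.single 1 b.toNNReal) f))⟫_ℂ := fun f => by
    rw [← hζ.apply_shift_mul _ (Pi.single 1 b.toNNReal) f,
      hζ.tModule_eq_one_of_suppIn_upper (hup f), one_mul]
  obtain ⟨g, g', rfl, hg, hg'⟩ := exists_add_suppIn (A := tModule a b ha hb)
    (B := {y | b ≤ y 1}) (measurableSet_le measurable_const (measurable_pi_apply 1)) f
  rw [key, _root_.map_add, _root_.map_add, adj_shift_comm_of_suppIn_upper hg, add_comm, hζ.apply_add_range,
    ← key, hζ.tModule_eq_one_of_suppIn_lower hg']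

theorem IsFockCocycle.tModule_eq_one (hζ : IsFockCocycle (shiftRep k (tModule a b ha hb)) ζ)
    (x : Orthant 2) (f : (tModule a b ha hb).L2 k) : ⟪ζ x, expVec f⟫_ℂ = 1 := by
  refine hζ.eq_one_of_single (fun i t f => ?_) x f
  fin_cases i
  · exact hζ.tModule_single_zero_eq_one t f
  -- Once the horizontal cocycle is trivial, the second factor in `apply_shift_mul` is `1` without
  -- any commutation, so the vertical coefficient is invariant under horizontal shifts.
  · refine hζ.eq_one_of_tendsto (y := fun n : ℕ => Pi.single 0 (n : ℝ≥0)) (fun n => ?_)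
      (tendsto_inner_shift_single _ 0 f)
    have := hζ.apply_shift_mul (Pi.single 1 t) (Pi.single 0 (n : ℝ≥0)) f
    rwa [hζ.tModule_single_zero_eq_one, mul_one] at this

end TModule

end ShiftSupport

end CCR

end

theorem mainTheorem7 {k : Type*} [NormedAddCommGroup k] [InnerProductSpace ℂ k] [CompleteSpace k]
    [TopologicalSpace.SeparableSpace k] :
    (∀ (d : ℕ), 2 ≤ d → ∀ (R : Fin d → Set ℝ) (hR : ∀ i, R i = Set.univ ∨ R i = Set.Ici 0),
      (∃ i, R i = Set.Ici 0) →
        {h | CCR.IsAdditiveCocycle (CCR.shiftRep k (CCR.prodModule R hR)) h} = {0} ∧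
        CCR.unitSet (CCR.ccrFlow (CCR.shiftRep k (CCR.prodModule R hR))) =
          {u | ∃ μ : Fin d → ℂ, u = fun x => Complex.exp (∑ i, (x i : ℂ) * μ i) •
            (CCR.secondQuant ((CCR.shiftRep k (CCR.prodModule R hR)).toFun x)).toContinuousLinearMap} ∧
        CCR.IsTypeII0 (CCR.ccrFlow (CCR.shiftRep k (CCR.prodModule R hR)))) ∧
    (∀ (a b : ℝ) (ha : a < 0) (hb : 0 < b),
        {h | CCR.IsAdditiveCocycle (CCR.shiftRep k (CCR.tModule a b ha hb)) h} = {0} ∧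
        CCR.unitSet (CCR.ccrFlow (CCR.shiftRep k (CCR.tModule a b ha hb))) =
          {u | ∃ μ : Fin 2 → ℂ, u = fun x => Complex.exp (∑ i, (x i : ℂ) * μ i) •
            (CCR.secondQuant ((CCR.shiftRep k (CCR.tModule a b ha hb)).toFun x)).toContinuousLinearMap} ∧
        CCR.IsTypeII0 (CCR.ccrFlow (CCR.shiftRep k (CCR.tModule a b ha hb)))) := by
  refine ⟨fun d hd R hR _ => ?_, fun a b ha hb => ?_⟩
  · exact CCR.cocycles_units_typeII0_of_fockCocycle_eq_one fun ζ hζ => hζ.prodModule_eq_one hd hR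
  · exact CCR.cocycles_units_typeII0_of_fockCocycle_eq_one fun ζ hζ => hζ.tModule_eq_one
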